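/- **Setting.** Let $H=(V,F)$ be a finite hypergraph: $V$ is a finite set and $F$ is a set of non-empty subsets of $V$. Let $d_i=|\{\alpha\in F: i\in\alpha\}|$. Directed edges are the pairs $e=(\alpha\to i)$ with $i\in\alpha\in F$; write $s(e)=\alpha$, $t(e)=i$, and $e\rightharpoonup e'$ if $t(e)\in s(e')$, $t(e)\ne t(e')$ and $s(e)\ne s(e')$. The directed edge matrix $\mathcal M$ has $\mathcal M_{e,e'}=1$ if $e'\rightharpoonup e$ and $0$ otherwise. Let $\kappa\ge 0$ be its Perron–Frobenius eigenvalue, i.e. its spectral radius ($\kappa^{-1}=\infty$ if $\kappa=0$). For a $\sigma$-finite base measure $\nu\neq 0$ and a measurable statistic $\phi$ with values in some $\mathbb R^N$, let $\psi(\theta)=\log\int e^{\langle\theta,\phi\rangle}d\nu$, $\Theta=\operatorname{int}\{\theta:\psi(\theta)<\infty\}$, and let $\{p_\theta=e^{\langle\theta,\phi\rangle-\psi(\theta)}:\theta\in\Theta\}$ be the exponential family generated by $\phi$. Let $\Lambda(\theta)=\mathbb E_{p_\theta}[\phi]$, $Y=\Lambda(\Theta)$, and $\varphi(\eta)=\sup_{\theta\in\Theta}(\langle\theta,\eta\rangle-\psi(\theta))$.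 An inference family $\mathcal I$ on $H$ consists of such families $\mathcal E_i$ on spaces $\mathcal X_i$ (statistic $\phi_i$, base measure $\nu_i$) for $i\in V$, and $\mathcal E_\alpha$ on $\prod_{i\in\alpha}\mathcal X_i$ (statistic $\phi_\alpha=(\phi_{\langle\alpha\rangle},(\phi_i)_{i\in\alpha})$, base measure $\prod_{i\in\alpha}\nu_i$) for $\alpha\in F$, such that the Hessians of all $\psi_i,\psi_\alpha$ are invertible on $\Theta_i,\Theta_\alpha$, and for all $i\in\alpha$ the $i$-th marginal of every member of $\mathcal E_\alpha$ belongs to $\mathcal E_i$. The set $L$ of pseudomarginals consists of all $\eta=((\eta_{\langle\alpha\rangle})_{\alpha\in F},(\eta_i)_{i\in V})$ such that $\eta_i\in Y_i$ for all $i$ and $\eta_\alpha:=(\eta_{\langle\alpha\rangle},(\eta_i)_{i\in\alpha})\in Y_\alpha$ for all $\alpha$; let $b_\alpha\in\mathcal E_\alpha$ be the density with expectation parameter $\eta_\alpha$. For compatibility functions $\Psi_\alpha=e^{\langle\bar\theta_\alpha,\phi_\alpha\rangle}$ the Bethe free energy is $$F(\eta)=-\sum_{\alpha\in F}\langle\bar\theta_\alpha,\eta_\alpha\rangle+\sum_{\alpha\in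 F}\varphi_\alpha(\eta_\alpha)+\sum_{i\in V}(1-d_i)\varphi_i(\eta_i).$$ **Claim.** Let $$L_{\kappa^{-1}}=\Big\{\eta\in L:\ \big\|\mathrm{Corr}_{b_\alpha}[\phi_i,\phi_j]\big\|<\kappa^{-1}\ \text{ for all }\alpha\in F\text{ and all } i\neq j\in\alpha\Big\},$$ where $\mathrm{Corr}_{b}[\phi_i,\phi_j]=\mathrm{Var}_b[\phi_i]^{-1/2}\,\mathrm{Cov}_b[\phi_i,\phi_j]\,\mathrm{Var}_b[\phi_j]^{-1/2}$ and $\|\cdot\|$ is the maximum singular value. Then at every point of $L_{\kappa^{-1}}$ the function $F$ is twice continuously differentiable, and its Hessian $\nabla^2F$ with respect to the coordinates $((\eta_{\langle\alpha\rangle})_\alpha,(\eta_i)_i)$ is positive definite. -/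

import Mathlib

open MeasureTheory ProbabilityTheory

/-! ### Second derivatives -/

/-- The Hessian matrix `(∂²f / ∂x_a ∂x_b)` of a function of finitely many real coordinates. -/
noncomputable def hessian {ι : Type*} [Fintype ι] [DecidableEq ι] (f : (ι → ℝ) → ℝ)
    (x : ι → ℝ) : Matrix ι ι ℝ :=
  Matrix.of fun a b =>
    fderiv ℝ (fun y => fderiv ℝ f y (Pi.single b 1)) x (Pi.single a 1)

/-! ### Exponential families

`ν` is the base measure on `X` and `φ` the (finite) vector of sufficient statistics. -/

namespace ExpFamily

variable {X : Type*} [MeasurableSpace X] {ι : Type*} [Fintype ι]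

/-- The natural parameter set `Θ = int {θ | ψ(θ) < ∞}`. -/
def natSpace (ν : Measure X) (φ : X → ι → ℝ) : Set (ι → ℝ) :=
  interior {θ | Integrable (fun x => Real.exp (∑ k, θ k * φ x k)) ν}

/-- The log partition function `ψ(θ) = log ∫ exp ⟨θ, φ⟩ dν`. -/
noncomputable def logPartition (ν : Measure X) (φ : X → ι → ℝ) (θ : ι → ℝ) : ℝ :=
  Real.log (∫ x, Real.exp (∑ k, θ k * φ x k) ∂ν)

/-- The probability law `exp (⟨θ, φ⟩ - ψ(θ)) dν` with natural parameter `θ`. -/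
noncomputable def law (ν : Measure X) (φ : X → ι → ℝ) (θ : ι → ℝ) : Measure X :=
  ν.tilted (fun x => ∑ k, θ k * φ x k)

/-- The expectation parameter map `Λ(θ) = E_θ[φ]`. -/
noncomputable def expParam (ν : Measure X) (φ : X → ι → ℝ) (θ : ι → ℝ) : ι → ℝ :=
  fun k => ∫ x, φ x k ∂(law ν φ θ)

/-- The set of expectation parameters `Y = Λ(Θ)`. -/
def expSpace (ν : Measure X) (φ : X → ι → ℝ) : Set (ι → ℝ) :=
  expParam ν φ '' natSpace ν φ

/-- The Legendre transform `φ(η) = sup_{θ ∈ Θ} (⟨θ, η⟩ - ψ(θ))` of the log partition function. -/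
noncomputable def legendre (ν : Measure X) (φ : X → ι → ℝ) (η : ι → ℝ) : ℝ :=
  ⨆ θ : natSpace ν φ, ((∑ k, (θ : ι → ℝ) k * η k) - logPartition ν φ θ)

/-- The inverse map `Λ⁻¹ : Y → Θ`. -/
noncomputable def invExpParam (ν : Measure X) (φ : X → ι → ℝ) (η : ι → ℝ) : ι → ℝ :=
  Function.invFunOn (expParam ν φ) (natSpace ν φ) η

end ExpFamily

/-! ### Covariance and correlation coefficient matrices -/

/-- The matrix `Cov_μ[f, g]` of two random vectors. -/
noncomputable def covMatrix {Ω ι κ : Type*} [MeasurableSpace Ω] (μ : Measure Ω)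
    (f : Ω → ι → ℝ) (g : Ω → κ → ℝ) : Matrix ι κ ℝ :=
  Matrix.of fun a b => covariance (fun ω => f ω a) (fun ω => g ω b) μ

section

open scoped MatrixOrder Matrix.Norms.L2Operator

/-- The correlation coefficient matrix
`Corr_μ[f, g] = Var_μ[f]^(-1/2) Cov_μ[f, g] Var_μ[g]^(-1/2)`, with symmetric positive
square roots. -/
noncomputable def corrMatrix {Ω ι κ : Type*} [MeasurableSpace Ω] [Fintype ι] [DecidableEq ι]
    [Fintype κ] [DecidableEq κ] (μ : Measure Ω) (f : Ω → ι → ℝ) (g : Ω → κ → ℝ) :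
    Matrix ι κ ℝ :=
  (CFC.sqrt (covMatrix μ f f))⁻¹ * covMatrix μ f g * (CFC.sqrt (covMatrix μ g g))⁻¹

/-- The operator norm for Euclidean norms, i.e. the maximum singular value. -/
noncomputable def opNorm {ι κ : Type*} [Fintype ι] [DecidableEq ι] [Fintype κ] [DecidableEq κ]
    (A : Matrix ι κ ℝ) : ℝ :=
  ‖A‖

end

/-! ### Hypergraphs -/

/-- A finite hypergraph with vertex set `V`: a set of non-empty subsets of `V`. -/
structure FactorGraph (V : Type*) [DecidableEq V] where
  edges : Finset (Finset V)
  nonempty_of_mem : ∀ α ∈ edges, α.Nonempty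

namespace FactorGraph

variable {V : Type*} [DecidableEq V] (H : FactorGraph V)

/-- The hyperedges (factors). -/
abbrev Factor : Type _ := {α : Finset V // α ∈ H.edges}

/-- The members of a hyperedge. -/
abbrev Member {H : FactorGraph V} (α : H.Factor) : Type _ := {i : V // i ∈ α.1}

/-- The degree `d_i`, the number of hyperedges that contain `i`. -/
def degree (i : V) : ℕ := (H.edges.filter fun α => i ∈ α).card

/-- The directed edges `α → i` with `i ∈ α`; `e.1` is the starting hyperedge `s(e)` and `e.2` the
terminus vertex `t(e)`. -/
abbrev DirEdge : Type _ := Σ α : H.Factor, Member α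

/-- The relation `e ⇀ e'`: `t(e) ∈ s(e')`, with `t(e) ≠ t(e')` and `s(e) ≠ s(e')`. -/
def Follows (e e' : H.DirEdge) : Prop :=
  e.2.1 ∈ e'.1.1 ∧ e.2.1 ≠ e'.2.1 ∧ e.1 ≠ e'.1

instance : DecidableRel H.Follows := fun _ _ => inferInstanceAs (Decidable (_ ∧ _ ∧ _))

/-- The directed edge matrix `M`: `M_{e,e'} = 1` if `e' ⇀ e`, and `0` otherwise. -/
def directedEdgeMatrix : Matrix H.DirEdge H.DirEdge ℂ :=
  Matrix.of fun e e' => if H.Follows e' e then 1 else 0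

/-- The Perron-Frobenius eigenvalue of the non-negative matrix `M`, that is, its spectral radius;
it is a finite element of `[0, ∞]`. -/
noncomputable def perronFrobenius : ENNReal := spectralRadius ℂ H.directedEdgeMatrix

end FactorGraph

/-! ### Inference families -/

/-- Sufficient statistics and base measures on a hypergraph, before any assumption on the
exponential families that they generate. -/
structure LocalStatistics {V : Type*} [Fintype V] [DecidableEq V] (H : FactorGraph V)
    (X : V → Type*) [∀ i, MeasurableSpace (X i)] where
  /-- the base measures `ν_i` -/
  base : ∀ i, Measure (X i)
  base_sigmaFinite : ∀ i, SigmaFinite (base i)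
  base_ne_zero : ∀ i, base i ≠ 0
  /-- the number of components of `φ_i` -/
  r : V → ℕ
  /-- the number of components of `φ_⟨α⟩` -/
  n : H.Factor → ℕ
  /-- the statistics `φ_i` -/
  vStat : ∀ i, X i → Fin (r i) → ℝ
  vStat_measurable : ∀ i, Measurable (vStat i)
  /-- the statistics `φ_⟨α⟩` -/
  fStat : ∀ α : H.Factor, (∀ i : FactorGraph.Member α, X i.1) → Fin (n α) → ℝ
  fStat_measurable : ∀ α, Measurable (fStat α)

namespace LocalStatistics

variable {V : Type*} [Fintype V] [DecidableEq V] {H : FactorGraph V}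
  {X : V → Type*} [∀ i, MeasurableSpace (X i)] (I : LocalStatistics H X)

/-- The configurations `x_α` of a factor. -/
abbrev Config (_ : LocalStatistics H X) (α : H.Factor) : Type _ :=
  ∀ i : FactorGraph.Member α, X i.1

/-- The index set of the components of `φ_α = (φ_⟨α⟩, φ_{i_1}, …, φ_{i_d})`. -/
abbrev FIndex (α : H.Factor) : Type _ :=
  Fin (I.n α) ⊕ (Σ i : FactorGraph.Member α, Fin (I.r i.1))

/-- The product measure `ν_α` of the `ν_i`, `i ∈ α`. -/
noncomputable def fBase (α : H.Factor) : Measure (I.Config α) :=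
  Measure.pi fun i : FactorGraph.Member α => I.base i.1

/-- The statistic `φ_i`, as a function of `x_α`. -/
def vStatOn (α : H.Factor) (i : FactorGraph.Member α) (x : I.Config α) : Fin (I.r i.1) → ℝ :=
  I.vStat i.1 (x i)

/-- The full statistic `φ_α`. -/
def fullStat (α : H.Factor) (x : I.Config α) : I.FIndex α → ℝ :=
  Sum.elim (I.fStat α x) fun p => I.vStatOn α p.1 x p.2

/-- The index set of the coordinates `((η_⟨α⟩)_α, (η_i)_i)`. -/
abbrev Coord : Type _ := (Σ α : H.Factor, Fin (I.n α)) ⊕ (Σ i : V, Fin (I.r i))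

/-- The vector `η_i`. -/
def vPart (η : I.Coord → ℝ) (i : V) : Fin (I.r i) → ℝ :=
  fun k => η (Sum.inr ⟨i, k⟩)

/-- The vector `η_α = (η_⟨α⟩, η_{i_1}, …, η_{i_d})`; its vertex components are the `η_i`, which is
the local consistency constraint. -/
def fPart (η : I.Coord → ℝ) (α : H.Factor) : I.FIndex α → ℝ :=
  Sum.elim (fun k => η (Sum.inl ⟨α, k⟩)) fun p => I.vPart η p.1.1 p.2

/-- The set `L` of pseudomarginals, in the coordinates `((η_⟨α⟩)_α, (η_i)_i)`. -/
def pseudomarginals : Set (I.Coord → ℝ) :=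
  {η | (∀ α, I.fPart η α ∈ ExpFamily.expSpace (I.fBase α) (I.fullStat α)) ∧
    ∀ i, I.vPart η i ∈ ExpFamily.expSpace (I.base i) (I.vStat i)}

/-- The law of `x_α` with density `b_α`, the member of the family of `α` with expectation
parameter `η_α`. -/
noncomputable def belief (η : I.Coord → ℝ) (α : H.Factor) : Measure (I.Config α) :=
  ExpFamily.law (I.fBase α) (I.fullStat α)
    (ExpFamily.invExpParam (I.fBase α) (I.fullStat α) (I.fPart η α))

/-- The Bethe free energy for the compatibility functions
`Ψ_α = exp ⟨θbar_α, φ_α⟩`. -/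
noncomputable def betheFreeEnergy (θbar : ∀ α : H.Factor, I.FIndex α → ℝ) (η : I.Coord → ℝ) : ℝ :=
  -(∑ α, ∑ k, θbar α k * I.fPart η α k)
    + ∑ α, ExpFamily.legendre (I.fBase α) (I.fullStat α) (I.fPart η α)
    + ∑ i, (1 - (H.degree i : ℝ)) * ExpFamily.legendre (I.base i) (I.vStat i) (I.vPart η i)

/-- The subset of `L` where, for all factors `α` and all distinct `i, j ∈ α`, the norm of
`Corr_{b_α}[φ_i, φ_j]` is less than `c`. -/
def pseudomarginalsBelow (c : ENNReal) : Set (I.Coord → ℝ) :=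
  {η | η ∈ I.pseudomarginals ∧
    ∀ (α : H.Factor) (i j : FactorGraph.Member α), i ≠ j →
      ENNReal.ofReal (opNorm (corrMatrix (I.belief η α) (I.vStatOn α i) (I.vStatOn α j))) < c}

end LocalStatistics

/-- An inference family: the log partition functions have invertible Hessians on the parameter
sets, and the families are closed under marginalization. -/
structure InferenceFamily {V : Type*} [Fintype V] [DecidableEq V] (H : FactorGraph V)
    (X : V → Type*) [∀ i, MeasurableSpace (X i)] extends LocalStatistics H X where
  vHessian_isUnit : ∀ i, ∀ θ ∈ ExpFamily.natSpace (base i) (vStat i),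
    IsUnit (hessian (ExpFamily.logPartition (base i) (vStat i)) θ)
  fHessian_isUnit : ∀ α, ∀ θ ∈ ExpFamily.natSpace (toLocalStatistics.fBase α)
      (toLocalStatistics.fullStat α),
    IsUnit (hessian (ExpFamily.logPartition (toLocalStatistics.fBase α)
      (toLocalStatistics.fullStat α)) θ)
  marginally_closed : ∀ (α : H.Factor) (i : FactorGraph.Member α),
    ∀ θ ∈ ExpFamily.natSpace (toLocalStatistics.fBase α) (toLocalStatistics.fullStat α),
      ∃ θ' ∈ ExpFamily.natSpace (base i.1) (vStat i.1),
        (ExpFamily.law (toLocalStatistics.fBase α) (toLocalStatistics.fullStat α) θ).map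
          (fun x => x i) = ExpFamily.law (base i.1) (vStat i.1) θ'

/-! The gradient of a Legendre transform inverts the expectation map, so its Hessian is an inverse
covariance matrix. With C_α = Var_{b_α}[φ_α] and W_i = Var[φ_i], the Hessian form of the Bethe free
energy at u is Σ_α ⟨u_α, C_α⁻¹ u_α⟩ + Σ_i (1 - d_i) a_i², where a_i² = ⟨u_i, W_i⁻¹ u_i⟩. Marginal
closure makes the vertex blocks of C_α equal to the W_i (`covMatrix_belief_eq`).

No determinant or zeta function identity is needed. For every z, ⟨x, C⁻¹x⟩ ≥ 2⟨z, x⟩ - ⟨z, Cz⟩.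
Testing with vertex blocks t_{α→i} W_i⁻¹ u_i and bounding all correlations by one β < κ⁻¹, the
factor α contributes at least Σ_i a_i² minus the error Σ_i (1 - t_{α→i})² a_i² + β Σ_{i≠j} t_{α→i}
t_{α→j} a_i a_j (`le_factor_quadratic`). Summed over α, the main terms give Σ_i d_i a_i² and cancel
the negative vertex terms, leaving Σ_i a_i² minus the total error.

The weights t come from a supersolution v ≥ β𝓜v + 1/2 on directed edges, which exists because βκ <
1. Let y_i be slightly more than the sum of all messages v into i, and let t_{α→i} be the share of
y_i that does not come from α. Then the total error is at most Σ_i (1 - c_i) a_i² with c_i > 0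
(`exists_weights`), so the form is positive when some u_i ≠ 0. If all u_i vanish, positive
definiteness of the C_α⁻¹ suffices (`bethe_quadratic_pos`). -/

/-! ### Smoothness of exponential integrals. -/

theorem Real.exp_mul_norm_le_one_add_sum {ι : Type*} [Fintype ι] {r : ℝ} (y : ι → ℝ) :
    Real.exp (r * ‖y‖) ≤ 1 + ∑ k, (Real.exp (r * y k) + Real.exp (-(r * y k))) := by
  have hnn : ∀ k, 0 ≤ Real.exp (r * y k) + Real.exp (-(r * y k)) := fun k => by positivity
  have hs : 0 ≤ ∑ k, (Real.exp (r * y k) + Real.exp (-(r * y k))) :=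
    Finset.sum_nonneg fun k _ => hnn k
  rcases isEmpty_or_nonempty ι with h | h
  · have : ‖y‖ = 0 := by rw [Subsingleton.elim y 0, norm_zero]
    rw [this, mul_zero, Real.exp_zero]
    linarith
  · obtain ⟨k, hk⟩ := Finite.exists_max fun k => |y k|
    have hy : ‖y‖ = |y k| :=
      le_antisymm ((pi_norm_le_iff_of_nonneg (abs_nonneg _)).2 fun i => hk i) (norm_le_pi_norm y k)
    have h1 := Finset.single_le_sum (fun k _ => hnn k) (Finset.mem_univ k)
    have h2 : Real.exp (r * ‖y‖) ≤ Real.exp (r * y k) + Real.exp (-(r * y k)) := by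
      rw [hy]
      rcases abs_choice (y k) with h | h <;> rw [h]
      · linarith [Real.exp_pos (-(r * y k))]
      · rw [mul_neg]
        linarith [Real.exp_pos (r * y k)]
    linarith

namespace ExpFamily

variable {X : Type*} [MeasurableSpace X] {ι : Type*} [Fintype ι] {ν : Measure X}
  {φ : X → ι → ℝ} {θ : ι → ℝ} {g : X → ℝ}

/-- The exponential integral `∫ g exp ⟨θ, φ⟩ dν`. -/
noncomputable def expIntegral (ν : Measure X) (φ : X → ι → ℝ) (g : X → ℝ) (θ : ι → ℝ) : ℝ :=
  ∫ x, g x * Real.exp (∑ k, θ k * φ x k) ∂ν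

/-- The functions `g` for which `g exp ⟨θ, φ⟩` is integrable for all natural parameters `θ`. -/
def IsExpIntegrable (ν : Measure X) (φ : X → ι → ℝ) (g : X → ℝ) : Prop :=
  ∀ θ ∈ natSpace ν φ, Integrable (fun x => g x * Real.exp (∑ k, θ k * φ x k)) ν

theorem isOpen_natSpace : IsOpen (natSpace ν φ) := isOpen_interior

theorem natSpace_subset :
    natSpace ν φ ⊆ {θ | Integrable (fun x => Real.exp (∑ k, θ k * φ x k)) ν} :=
  interior_subset

theorem integrable_exp (hθ : θ ∈ natSpace ν φ) :
    Integrable (fun x => Real.exp (∑ k, θ k * φ x k)) ν := by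
  have h := natSpace_subset hθ
  rwa [Set.mem_ofPred_eq] at h

theorem isExpIntegrable_one : IsExpIntegrable ν φ fun _ => 1 := fun θ hθ => by
  simpa using integrable_exp hθ

/-- Θ is open, so θ can be moved both ways along each axis. The resulting finitely many integrable
functions together dominate the factor exp (r‖φ‖). -/
theorem IsExpIntegrable.exists_integrable_exp_norm (hφ : Measurable φ)
    (hg : IsExpIntegrable ν φ g) (hθ : θ ∈ natSpace ν φ) :
    ∃ r > 0, Integrable
      (fun x => |g x| * Real.exp (∑ k, θ k * φ x k) * Real.exp (r * ‖φ x‖)) ν := by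
  classical
  obtain ⟨ε, hε, hball⟩ := Metric.isOpen_iff.1 isOpen_natSpace θ hθ
  have hmem : ∀ k, ∀ s : ℝ, |s| ≤ ε / 2 → θ + Pi.single k s ∈ natSpace ν φ := fun k s hs => by
    apply hball
    rw [mem_ball_iff_norm, add_sub_cancel_left, Pi.norm_single, Real.norm_eq_abs]
    linarith
  have hsum : ∀ k, ∀ s : ℝ, ∀ x, ∑ j, (θ + Pi.single k s : ι → ℝ) j * φ x j
      = ∑ j, θ j * φ x j + s * φ x k := fun k s x => by
    simp [add_mul, Finset.sum_add_distrib, Pi.single_apply]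
  have habs : |ε / 2| ≤ ε / 2 := (abs_of_pos (by linarith)).le
  refine ⟨ε / 2, by linarith, ?_⟩
  have hint : Integrable (fun x => ‖g x * Real.exp (∑ k, θ k * φ x k)‖ +
      ∑ k, (‖g x * Real.exp (∑ j, (θ + Pi.single k (ε / 2) : ι → ℝ) j * φ x j)‖ +
        ‖g x * Real.exp (∑ j, (θ + Pi.single k (-(ε / 2)) : ι → ℝ) j * φ x j)‖)) ν := by
    refine (hg θ hθ).norm.add (integrable_finsetSum _ fun k _ => ?_)
    exact (hg _ (hmem k _ habs)).norm.add (hg _ (hmem k _ (by rwa [abs_neg]))).norm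
  refine hint.mono' ?_ (Filter.Eventually.of_forall fun x => ?_)
  · have h1 : AEStronglyMeasurable (fun x => |g x| * Real.exp (∑ k, θ k * φ x k)) ν := by
      refine (hg θ hθ).norm.aestronglyMeasurable.congr (Filter.Eventually.of_forall fun x => ?_)
      simp
    exact h1.mul (by fun_prop : Measurable fun x => Real.exp (ε / 2 * ‖φ x‖)).aestronglyMeasurable
  · simp only [hsum, Real.exp_add, norm_mul, Real.norm_eq_abs, Real.abs_exp, abs_abs]
    calc |g x| * Real.exp (∑ k, θ k * φ x k) * Real.exp (ε / 2 * ‖φ x‖)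
        ≤ |g x| * Real.exp (∑ k, θ k * φ x k) *
          (1 + ∑ k, (Real.exp (ε / 2 * φ x k) + Real.exp (-(ε / 2 * φ x k)))) := by
          gcongr
          exact Real.exp_mul_norm_le_one_add_sum _
      _ = _ := by
          rw [mul_add, mul_one, Finset.mul_sum]
          congr 1
          refine Finset.sum_congr rfl fun k _ => ?_
          rw [neg_mul]
          ring

theorem norm_le_two_div_mul_exp {E : Type*} [NormedAddCommGroup E] {r : ℝ} (hr : 0 < r) (y : E) :
    ‖y‖ ≤ 2 / r * Real.exp (r / 2 * ‖y‖) := by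
  have h := Real.add_one_le_exp (r / 2 * ‖y‖)
  calc ‖y‖ = 2 / r * (r / 2 * ‖y‖) := by field_simp
    _ ≤ _ := by gcongr; linarith

theorem abs_sum_mul_le (θ y : ι → ℝ) :
    |∑ k, θ k * y k| ≤ Fintype.card ι * ‖θ‖ * ‖y‖ := by
  calc |∑ k, θ k * y k| ≤ ∑ k, |θ k * y k| := Finset.abs_sum_le_sum_abs _ _
    _ ≤ ∑ _k : ι, ‖θ‖ * ‖y‖ := by
        refine Finset.sum_le_sum fun k _ => ?_
        rw [abs_mul]
        exact mul_le_mul (norm_le_pi_norm θ k) (norm_le_pi_norm y k) (abs_nonneg _) (norm_nonneg _)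
    _ = _ := by simp [mul_assoc]

/-- The hypothesis of domination for differentiation under the integral sign. -/
theorem IsExpIntegrable.exists_dominating (hφ : Measurable φ)
    (hg : IsExpIntegrable ν φ g) (hθ : θ ∈ natSpace ν φ) :
    ∃ s ∈ nhds θ, ∃ b : X → ℝ, Integrable b ν ∧ ∀ θ' ∈ s, ∀ x,
      |g x| * ‖φ x‖ * Real.exp (∑ k, θ' k * φ x k) ≤ b x := by
  obtain ⟨r, hr, hint⟩ := hg.exists_integrable_exp_norm hφ hθ
  set n : ℝ := (Fintype.card ι : ℝ)
  have hn : 0 ≤ n := Nat.cast_nonneg _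
  -- The exponent r‖φ‖ is spent in two halves: one absorbs the factor ‖φ‖, the other the shift from
  -- θ to θ'. The radius makes that shift at most r/2 · ‖φ‖; n + 1 keeps it meaningful for empty
  -- `ι`.
  refine ⟨Metric.ball θ (r / (2 * (n + 1))), Metric.ball_mem_nhds _ (by positivity), _,
    hint.const_mul (2 / r), fun θ' hθ' x => ?_⟩
  rw [mem_ball_iff_norm] at hθ'
  have h1 : ∑ k, θ' k * φ x k ≤ ∑ k, θ k * φ x k + r / 2 * ‖φ x‖ := by
    have h2 : ∑ k, θ' k * φ x k = ∑ k, θ k * φ x k + ∑ k, (θ' - θ) k * φ x k := by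
      simp [sub_mul]
    have h3 := (le_abs_self _).trans (abs_sum_mul_le (θ' - θ) (φ x))
    have h4 : n * ‖θ' - θ‖ ≤ r / 2 := by
      calc n * ‖θ' - θ‖ ≤ (n + 1) * (r / (2 * (n + 1))) := by gcongr; linarith
        _ = r / 2 := by field_simp
    have h5 := mul_le_mul_of_nonneg_right h4 (norm_nonneg (φ x))
    linarith
  calc |g x| * ‖φ x‖ * Real.exp (∑ k, θ' k * φ x k)
      ≤ |g x| * (2 / r * Real.exp (r / 2 * ‖φ x‖)) *
        (Real.exp (∑ k, θ k * φ x k) * Real.exp (r / 2 * ‖φ x‖)) := by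
        rw [← Real.exp_add]
        gcongr
        exact norm_le_two_div_mul_exp hr _
    _ = 2 / r * (|g x| * Real.exp (∑ k, θ k * φ x k) *
        (Real.exp (r / 2 * ‖φ x‖) * Real.exp (r / 2 * ‖φ x‖))) := by ring
    _ = _ := by
        rw [← Real.exp_add]
        ring_nf

/-- Differentiating under the integral multiplies the integrand by a component of φ; this closure
property drives the induction on the order of smoothness. -/
theorem IsExpIntegrable.mul_stat (hφ : Measurable φ) (hg : IsExpIntegrable ν φ g) (k : ι) :
    IsExpIntegrable ν φ fun x => g x * φ x k := fun θ hθ => by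
  obtain ⟨s, hs, b, hb, hle⟩ := hg.exists_dominating hφ hθ
  refine hb.mono' ?_ (Filter.Eventually.of_forall fun x => ?_)
  · have h : Measurable fun x => φ x k := by fun_prop
    refine ((hg θ hθ).aestronglyMeasurable.mul h.aestronglyMeasurable).congr
      (Filter.Eventually.of_forall fun x => ?_)
    simp only [Pi.mul_apply]
    ring
  · refine le_trans ?_ (hle θ (mem_of_mem_nhds hs) x)
    rw [norm_mul, norm_mul, Real.norm_eq_abs, Real.norm_eq_abs (Real.exp _), Real.abs_exp]
    gcongr
    exact norm_le_pi_norm (φ x) k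

theorem hasFDerivAt_mul_exp_sum (c : ℝ) (y : ι → ℝ) (θ : ι → ℝ) :
    HasFDerivAt (fun θ : ι → ℝ => c * Real.exp (∑ k, θ k * y k))
      (∑ k, (c * y k * Real.exp (∑ j, θ j * y j)) •
        (ContinuousLinearMap.proj k : (ι → ℝ) →L[ℝ] ℝ)) θ := by
  have h : HasFDerivAt (fun θ : ι → ℝ => ∑ k, θ k * y k)
      (∑ k, y k • (ContinuousLinearMap.proj k : (ι → ℝ) →L[ℝ] ℝ)) θ :=
    HasFDerivAt.fun_sum fun k _ =>
      ((ContinuousLinearMap.proj k : (ι → ℝ) →L[ℝ] ℝ).hasFDerivAt).mul_const (y k)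
  refine (h.exp.const_mul c).congr_fderiv ?_
  ext v
  simp only [smul_eq_mul, smul_apply, sum_apply,
    ContinuousLinearMap.proj_apply, Finset.mul_sum]
  exact Finset.sum_congr rfl fun k _ => by ring

theorem IsExpIntegrable.hasFDerivAt (hφ : Measurable φ) (hg : IsExpIntegrable ν φ g)
    (hθ : θ ∈ natSpace ν φ) :
    HasFDerivAt (expIntegral ν φ g)
      (∑ k, expIntegral ν φ (fun x => g x * φ x k) θ •
        (ContinuousLinearMap.proj k : (ι → ℝ) →L[ℝ] ℝ)) θ := by
  obtain ⟨s, hs, b, hb, hle⟩ := hg.exists_dominating hφ hθ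
  have hint : ∀ k, Integrable (fun x => (g x * φ x k * Real.exp (∑ j, θ j * φ x j)) •
      (ContinuousLinearMap.proj k : (ι → ℝ) →L[ℝ] ℝ)) ν := by
    intro k
    have h := hg.mul_stat hφ k θ hθ
    exact h.smul_const _
  have hint' : Integrable (fun x => ∑ k, (g x * φ x k * Real.exp (∑ j, θ j * φ x j)) •
      (ContinuousLinearMap.proj k : (ι → ℝ) →L[ℝ] ℝ)) ν :=
    integrable_finsetSum (ε' := (ι → ℝ) →L[ℝ] ℝ) Finset.univ fun k _ => hint k
  have hmeas : ∀ᶠ θ' in nhds θ,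
      AEStronglyMeasurable (fun x => g x * Real.exp (∑ k, θ' k * φ x k)) ν := by
    filter_upwards [isOpen_natSpace.mem_nhds hθ] with θ' hθ' using (hg θ' hθ').aestronglyMeasurable
  have hbound : ∀ᵐ x ∂ν, ∀ θ' ∈ s, ‖∑ k, (g x * φ x k * Real.exp (∑ j, θ' j * φ x j)) •
      (ContinuousLinearMap.proj k : (ι → ℝ) →L[ℝ] ℝ)‖ ≤
      ∑ k, b x * ‖(ContinuousLinearMap.proj k : (ι → ℝ) →L[ℝ] ℝ)‖ := by
    refine Filter.Eventually.of_forall fun x θ' hθ' => (norm_sum_le _ _).trans ?_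
    refine Finset.sum_le_sum fun k _ => ?_
    rw [norm_smul]
    gcongr
    refine le_trans ?_ (hle θ' hθ' x)
    rw [norm_mul, norm_mul, Real.norm_eq_abs, Real.norm_eq_abs (Real.exp _), Real.abs_exp]
    gcongr
    exact norm_le_pi_norm (φ x) k
  have hb' : Integrable
      (fun x => ∑ k, b x * ‖(ContinuousLinearMap.proj k : (ι → ℝ) →L[ℝ] ℝ)‖) ν :=
    integrable_finsetSum _ fun k _ => hb.mul_const _
  have key := hasFDerivAt_integral_of_dominated_of_fderiv_le hs hmeas (hg θ hθ)
    hint'.aestronglyMeasurable hbound hb'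
    (Filter.Eventually.of_forall fun x θ' _ => hasFDerivAt_mul_exp_sum _ _ _)
  refine key.congr_fderiv ?_
  rw [integral_finsetSum _ fun k _ => hint k]
  refine Finset.sum_congr rfl fun k _ => ?_
  rw [integral_smul_const]
  rfl

theorem IsExpIntegrable.contDiffOn (hφ : Measurable φ) (hg : IsExpIntegrable ν φ g) (n : ℕ) :
    ContDiffOn ℝ n (expIntegral ν φ g) (natSpace ν φ) := by
  induction n generalizing g with
  | zero =>
    exact contDiffOn_zero.2 fun θ hθ => (hg.hasFDerivAt hφ hθ).continuousAt.continuousWithinAt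
  | succ n ih =>
    rw [Nat.cast_add, Nat.cast_one, contDiffOn_succ_iff_fderiv_of_isOpen isOpen_natSpace]
    refine ⟨fun θ hθ => (hg.hasFDerivAt hφ hθ).differentiableAt.differentiableWithinAt,
      fun h => absurd h (by simp), ?_⟩
    refine ContDiffOn.congr (f := fun θ => ∑ k, expIntegral ν φ (fun x => g x * φ x k) θ •
        (ContinuousLinearMap.proj k : (ι → ℝ) →L[ℝ] ℝ)) ?_ fun θ hθ => (hg.hasFDerivAt hφ hθ).fderiv
    exact ContDiffOn.sum fun k _ => (ih (hg.mul_stat hφ k)).smul contDiffOn_const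

theorem IsExpIntegrable.contDiffAt (hφ : Measurable φ) (hg : IsExpIntegrable ν φ g) (n : ℕ)
    (hθ : θ ∈ natSpace ν φ) : ContDiffAt ℝ n (expIntegral ν φ g) θ :=
  (hg.contDiffOn hφ n).contDiffAt (isOpen_natSpace.mem_nhds hθ)

/-! ### Derivatives of the log partition function and of the expectation map. -/

theorem expIntegral_one :
    expIntegral ν φ (fun _ => 1) = fun θ => ∫ x, Real.exp (∑ k, θ k * φ x k) ∂ν := by
  simp [funext_iff, expIntegral]

theorem logPartition_eq : logPartition ν φ = fun θ => Real.log (expIntegral ν φ (fun _ => 1) θ) := by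
  simp only [expIntegral_one]
  rfl

theorem integral_law (g : X → ℝ) :
    ∫ x, g x ∂(law ν φ θ) = expIntegral ν φ g θ / expIntegral ν φ (fun _ => 1) θ := by
  rw [law, integral_tilted, expIntegral_one, expIntegral, ← integral_div]
  exact integral_congr_ae (Filter.Eventually.of_forall fun x => by simp only [smul_eq_mul]; ring)

theorem IsExpIntegrable.integrable_law (hg : IsExpIntegrable ν φ g) (hθ : θ ∈ natSpace ν φ) :
    Integrable g (law ν φ θ) := by
  rw [law, integrable_tilted_iff (integrable_exp hθ)]
  simpa [mul_comm] using hg θ hθ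

theorem isExpIntegrable_stat (hφ : Measurable φ) (k : ι) : IsExpIntegrable ν φ fun x => φ x k := by
  simpa using isExpIntegrable_one.mul_stat hφ k

theorem expParam_eq (k : ι) : expParam ν φ θ k =
    expIntegral ν φ (fun x => φ x k) θ / expIntegral ν φ (fun _ => 1) θ := integral_law _

theorem memLp_stat (hφ : Measurable φ) (hθ : θ ∈ natSpace ν φ) (k : ι) :
    MemLp (fun x => φ x k) 2 (law ν φ θ) := by
  have h : Measurable fun x => φ x k := by fun_prop
  rw [memLp_two_iff_integrable_sq h.aestronglyMeasurable]
  simpa [sq] using ((isExpIntegrable_stat hφ k).mul_stat hφ k).integrable_law hθ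

variable [NeZero ν]

theorem isProbabilityMeasure_law (hθ : θ ∈ natSpace ν φ) : IsProbabilityMeasure (law ν φ θ) :=
  isProbabilityMeasure_tilted (integrable_exp hθ)

theorem expIntegral_one_pos (hθ : θ ∈ natSpace ν φ) : 0 < expIntegral ν φ (fun _ => 1) θ := by
  rw [expIntegral_one]
  exact integral_exp_pos (integrable_exp hθ)

theorem covMatrix_law_eq (hφ : Measurable φ) (hθ : θ ∈ natSpace ν φ) (a b : ι) :
    covMatrix (law ν φ θ) φ φ a b =
      expIntegral ν φ (fun x => φ x a * φ x b) θ / expIntegral ν φ (fun _ => 1) θ -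
        expParam ν φ θ a * expParam ν φ θ b := by
  have := isProbabilityMeasure_law hθ
  rw [covMatrix, Matrix.of_apply, covariance_eq_sub (memLp_stat hφ hθ a) (memLp_stat hφ hθ b)]
  simp only [Pi.mul_apply, integral_law, expParam_eq]

theorem contDiffAt_expParam (hφ : Measurable φ) (n : ℕ) (hθ : θ ∈ natSpace ν φ) :
    ContDiffAt ℝ n (expParam ν φ) θ := by
  rw [contDiffAt_pi]
  intro k
  simp only [expParam_eq]
  exact ((isExpIntegrable_stat hφ k).contDiffAt hφ n hθ).div
    (isExpIntegrable_one.contDiffAt hφ n hθ) (expIntegral_one_pos hθ).ne'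

theorem hasFDerivAt_logPartition (hφ : Measurable φ) (hθ : θ ∈ natSpace ν φ) :
    HasFDerivAt (logPartition ν φ)
      (∑ k, expParam ν φ θ k • (ContinuousLinearMap.proj k : (ι → ℝ) →L[ℝ] ℝ)) θ := by
  rw [logPartition_eq]
  refine ((isExpIntegrable_one.hasFDerivAt hφ hθ).log
    (expIntegral_one_pos hθ).ne').congr_fderiv ?_
  rw [Finset.smul_sum]
  refine Finset.sum_congr rfl fun k _ => ?_
  rw [smul_smul, expParam_eq]
  simp only [one_mul]
  congr 1
  ring

variable [DecidableEq ι]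

theorem hasFDerivAt_expParam (hφ : Measurable φ) (hθ : θ ∈ natSpace ν φ) :
    HasFDerivAt (expParam ν φ)
      (Matrix.toLin' (covMatrix (law ν φ θ) φ φ)).toContinuousLinearMap θ := by
  rw [hasFDerivAt_pi']
  intro a
  simp only [expParam_eq]
  have hne := (expIntegral_one_pos hθ).ne'
  simp only [div_eq_mul_inv]
  refine (((isExpIntegrable_stat hφ a).hasFDerivAt hφ hθ).fun_mul
    ((hasDerivAt_inv hne).comp_hasFDerivAt θ
      (isExpIntegrable_one.hasFDerivAt hφ hθ))).congr_fderiv ?_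
  ext v
  simp only [one_mul, ContinuousLinearMap.comp_apply, LinearMap.coe_toContinuousLinearMap',
    Matrix.toLin'_apply, ContinuousLinearMap.proj_apply, Matrix.mulVec, dotProduct,
    covMatrix_law_eq hφ hθ, expParam_eq, add_apply,
    smul_apply, sum_apply, smul_eq_mul, Finset.mul_sum,
    ← Finset.sum_add_distrib, Function.comp_apply]
  refine Finset.sum_congr rfl fun k _ => ?_
  field_simp
  ring

theorem hessian_logPartition (hφ : Measurable φ) (hθ : θ ∈ natSpace ν φ) :
    hessian (logPartition ν φ) θ = covMatrix (law ν φ θ) φ φ := by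
  ext a b
  rw [hessian, Matrix.of_apply]
  have h : (fun y => fderiv ℝ (logPartition ν φ) y (Pi.single b 1)) =ᶠ[nhds θ]
      fun y => expParam ν φ y b := by
    filter_upwards [isOpen_natSpace.mem_nhds hθ] with y hy
    rw [(hasFDerivAt_logPartition hφ hy).fderiv]
    simp [Pi.single_apply]
  rw [h.fderiv_eq, (hasFDerivAt_pi'.1 (hasFDerivAt_expParam hφ hθ) b).fderiv]
  simp only [ContinuousLinearMap.comp_apply, LinearMap.coe_toContinuousLinearMap',
    Matrix.toLin'_apply, ContinuousLinearMap.proj_apply, Matrix.mulVec_single_one, Matrix.col_apply]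
  simp [covMatrix, covariance_comm]

end ExpFamily

/-! ### The Legendre transform and its second derivative. -/

namespace ExpFamily

variable {X : Type*} [MeasurableSpace X] {ι : Type*} [Fintype ι] {ν : Measure X}
  {φ : X → ι → ℝ} {θ θ' : ι → ℝ} [NeZero ν]

/-- This is Jensen's inequality: with u = ⟨θ' - θ, φ⟩ and c its mean under θ, integrate exp u ≥ exp
c · (1 + u - c) against exp ⟨θ, φ⟩ and take logarithms. -/
theorem logPartition_add_le (hφ : Measurable φ) (hθ : θ ∈ natSpace ν φ) (hθ' : θ' ∈ natSpace ν φ) :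
    logPartition ν φ θ + ∑ k, (θ' k - θ k) * expParam ν φ θ k ≤ logPartition ν φ θ' := by
  set c := ∑ k, (θ' k - θ k) * expParam ν φ θ k with hc
  have hZ := expIntegral_one_pos hθ
  have hZ' := expIntegral_one_pos hθ'
  have hint : ∀ k, Integrable
      (fun x => (θ' k - θ k) * (φ x k * Real.exp (∑ j, θ j * φ x j))) ν := fun k =>
    (isExpIntegrable_stat hφ k θ hθ).const_mul _
  have hone : Integrable (fun x => (1 - c) * (1 * Real.exp (∑ j, θ j * φ x j))) ν :=
    (isExpIntegrable_one θ hθ).const_mul _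
  have hsum : Integrable (fun x => ∑ k, (θ' k - θ k) * (φ x k * Real.exp (∑ j, θ j * φ x j))) ν :=
    integrable_finsetSum _ fun k _ => hint k
  have hle : Real.exp c * expIntegral ν φ (fun _ => 1) θ ≤ expIntegral ν φ (fun _ => 1) θ' := by
    have h1 : ∫ x, Real.exp c * ((1 - c) * (1 * Real.exp (∑ j, θ j * φ x j)) +
        ∑ k, (θ' k - θ k) * (φ x k * Real.exp (∑ j, θ j * φ x j))) ∂ν =
        Real.exp c * expIntegral ν φ (fun _ => 1) θ := by
      have e1 : ∫ x, (1 - c) * (1 * Real.exp (∑ j, θ j * φ x j)) ∂ν =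
          (1 - c) * expIntegral ν φ (fun _ => 1) θ := integral_const_mul _ _
      have e2 : ∀ k, ∫ x, (θ' k - θ k) * (φ x k * Real.exp (∑ j, θ j * φ x j)) ∂ν =
          (θ' k - θ k) * expIntegral ν φ (fun x => φ x k) θ := fun k => integral_const_mul _ _
      rw [integral_const_mul, integral_add hone hsum, integral_finsetSum _ fun k _ => hint k, e1]
      simp only [e2]
      have h2 : ∀ k, expIntegral ν φ (fun x => φ x k) θ =
          expParam ν φ θ k * expIntegral ν φ (fun _ => 1) θ := fun k => by
        rw [expParam_eq]
        field_simp
      simp only [h2, ← mul_assoc, ← Finset.sum_mul]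
      rw [← hc]
      ring
    rw [← h1]
    refine integral_mono ((hone.add hsum).const_mul _) (isExpIntegrable_one θ' hθ') fun x => ?_
    set u := ∑ k, (θ' k - θ k) * φ x k with hu
    have h3 : ∑ k, θ' k * φ x k = ∑ k, θ k * φ x k + c + (u - c) := by
      rw [hu]
      simp [sub_mul]
    have h4 : ∑ k, (θ' k - θ k) * (φ x k * Real.exp (∑ j, θ j * φ x j)) =
        u * Real.exp (∑ j, θ j * φ x j) := by
      simp only [← mul_assoc, ← Finset.sum_mul]
      rw [hu]
    simp only [h3, h4, one_mul, Real.exp_add]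
    have h5 := Real.add_one_le_exp (u - c)
    calc Real.exp c * ((1 - c) * Real.exp (∑ j, θ j * φ x j) + u * Real.exp (∑ j, θ j * φ x j))
        = Real.exp (∑ j, θ j * φ x j) * Real.exp c * (u - c + 1) := by ring
      _ ≤ _ := by gcongr
  have h := Real.log_le_log (by positivity) hle
  rw [Real.log_mul (Real.exp_pos _).ne' hZ.ne', Real.log_exp] at h
  rw [logPartition_eq]
  simp only
  linarith

/-- The tangent inequality says that θ attains the supremum. It does so for any preimage θ, so
injectivity of the expectation map is not needed. -/
theorem legendre_expParam (hφ : Measurable φ) (hθ : θ ∈ natSpace ν φ) :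
    legendre ν φ (expParam ν φ θ) =
      (∑ k, θ k * expParam ν φ θ k) - logPartition ν φ θ := by
  have hle : ∀ θ' : natSpace ν φ,
      (∑ k, (θ' : ι → ℝ) k * expParam ν φ θ k) - logPartition ν φ θ' ≤
      (∑ k, θ k * expParam ν φ θ k) - logPartition ν φ θ := fun θ' => by
    have h := logPartition_add_le hφ hθ θ'.2
    simp only [sub_mul, Finset.sum_sub_distrib] at h
    linarith
  have : Nonempty (natSpace ν φ) := ⟨⟨θ, hθ⟩⟩
  exact le_antisymm (ciSup_le hle)
    (le_ciSup (f := fun θ' : natSpace ν φ =>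
      (∑ k, (θ' : ι → ℝ) k * expParam ν φ θ k) - logPartition ν φ θ')
      ⟨_, Set.forall_mem_range.2 hle⟩ ⟨θ, hθ⟩)

variable [DecidableEq ι]

/-- On the set of expectation parameters the gradient of the Legendre transform is locally a `C¹`
inverse of the expectation parameter map. -/
theorem exists_gradient_legendre (hφ : Measurable φ) (hθ : θ ∈ natSpace ν φ)
    (hunit : IsUnit (covMatrix (law ν φ θ) φ φ)) :
    ∃ T : (ι → ℝ) → ι → ℝ, ContDiffAt ℝ 1 T (expParam ν φ θ) ∧
      HasFDerivAt T (Matrix.toLin' (covMatrix (law ν φ θ) φ φ)⁻¹).toContinuousLinearMap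
        (expParam ν φ θ) ∧
      ∀ᶠ η in nhds (expParam ν φ θ), HasFDerivAt (legendre ν φ)
        (∑ k, T η k • (ContinuousLinearMap.proj k : (ι → ℝ) →L[ℝ] ℝ)) η := by
  set C := covMatrix (law ν φ θ) φ φ with hC
  have hdet : IsUnit C.det := (Matrix.isUnit_iff_isUnit_det _).1 hunit
  let e : (ι → ℝ) ≃L[ℝ] (ι → ℝ) := ContinuousLinearEquiv.equivOfInverse
    (Matrix.toLin' C).toContinuousLinearMap (Matrix.toLin' C⁻¹).toContinuousLinearMap
    (fun v => by simp [Matrix.mulVec_mulVec, Matrix.nonsing_inv_mul C hdet])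
    (fun v => by simp [Matrix.mulVec_mulVec, Matrix.mul_nonsing_inv C hdet])
  have he : HasFDerivAt (expParam ν φ) (e : (ι → ℝ) →L[ℝ] (ι → ℝ)) θ :=
    (hasFDerivAt_expParam hφ hθ).congr_fderiv (by ext; rfl)
  have hcd : ContDiffAt ℝ 1 (expParam ν φ) θ := by
    simpa using contDiffAt_expParam hφ 1 hθ
  have hs : HasStrictFDerivAt (expParam ν φ) (e : (ι → ℝ) →L[ℝ] (ι → ℝ)) θ :=
    hcd.hasStrictFDerivAt' he one_ne_zero
  have hT : ContDiffAt ℝ 1 (hcd.localInverse he one_ne_zero) (expParam ν φ θ) :=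
    hcd.to_localInverse he one_ne_zero
  have hT' : HasFDerivAt (hcd.localInverse he one_ne_zero)
      (e.symm : (ι → ℝ) →L[ℝ] (ι → ℝ)) (expParam ν φ θ) := hs.to_localInverse.hasFDerivAt
  have hinv : ∀ᶠ η in nhds (expParam ν φ θ),
      expParam ν φ (hcd.localInverse he one_ne_zero η) = η := hs.eventually_right_inverse
  have hfix : hcd.localInverse he one_ne_zero (expParam ν φ θ) = θ := hs.localInverse_apply_image
  set T := hcd.localInverse he one_ne_zero
  have hmem : ∀ᶠ η in nhds (expParam ν φ θ), T η ∈ natSpace ν φ :=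
    hT.continuousAt.eventually_mem (by rw [hfix]; exact isOpen_natSpace.mem_nhds hθ)
  have hdiff : ∀ᶠ η in nhds (expParam ν φ θ), DifferentiableAt ℝ T η :=
    (hT.eventually (by simp)).mono fun η h => h.differentiableAt one_ne_zero
  refine ⟨T, hT, hT'.congr_fderiv (by ext; rfl), ?_⟩
  have hleg : ∀ᶠ η in nhds (expParam ν φ θ),
      legendre ν φ η = (∑ k, T η k * η k) - logPartition ν φ (T η) := by
    filter_upwards [hinv, hmem] with η h1 h2
    have h3 := legendre_expParam hφ h2
    rwa [h1] at h3
  -- In the derivative of ⟨T η, η⟩ - ψ(T η) the two terms with the derivative of T cancel, since the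
  -- gradient of ψ at T η is η. What remains is T η.
  filter_upwards [hinv, hmem, hdiff, hleg.eventually_nhds] with η h1 h2 h3 h4
  refine HasFDerivAt.congr_of_eventuallyEq ?_ h4
  have h5 := (hasFDerivAt_logPartition hφ h2).comp η h3.hasFDerivAt
  have h6 : HasFDerivAt (fun η : ι → ℝ => ∑ k, T η k * η k)
      (∑ k, (T η k • (ContinuousLinearMap.proj k : (ι → ℝ) →L[ℝ] ℝ) +
        η k • (ContinuousLinearMap.proj k).comp (fderiv ℝ T η))) η :=
    HasFDerivAt.fun_sum fun k _ => (hasFDerivAt_pi'.1 h3.hasFDerivAt k).mul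
      (ContinuousLinearMap.proj k : (ι → ℝ) →L[ℝ] ℝ).hasFDerivAt
  refine (h6.sub h5).congr_fderiv ?_
  ext v
  simp [h1, Finset.sum_add_distrib]

theorem contDiffAt_legendre (hφ : Measurable φ) (hθ : θ ∈ natSpace ν φ)
    (hunit : IsUnit (covMatrix (law ν φ θ) φ φ)) :
    ContDiffAt ℝ 2 (legendre ν φ) (expParam ν φ θ) := by
  obtain ⟨T, hT, -, hev⟩ := exists_gradient_legendre hφ hθ hunit
  rw [show (2 : WithTop ℕ∞) = ((1 : ℕ) : WithTop ℕ∞) + 1 by norm_num,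
    contDiffAt_succ_iff_hasFDerivAt]
  refine ⟨_, ⟨_, hev, fun x hx => hx⟩, ?_⟩
  refine ContDiffAt.sum fun k _ => ContDiffAt.fun_smul ?_ contDiffAt_const
  exact contDiffAt_pi.1 (by simpa using hT) k

theorem iteratedFDeriv_two_legendre (hφ : Measurable φ) (hθ : θ ∈ natSpace ν φ)
    (hunit : IsUnit (covMatrix (law ν φ θ) φ φ)) (u v : ι → ℝ) :
    iteratedFDeriv ℝ 2 (legendre ν φ) (expParam ν φ θ) ![u, v] =
      (covMatrix (law ν φ θ) φ φ)⁻¹.mulVec u ⬝ᵥ v := by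
  obtain ⟨T, -, hT, hev⟩ := exists_gradient_legendre hφ hθ hunit
  have h : fderiv ℝ (legendre ν φ) =ᶠ[nhds (expParam ν φ θ)]
      fun η => ∑ k, T η k • (ContinuousLinearMap.proj k : (ι → ℝ) →L[ℝ] ℝ) :=
    hev.mono fun η h => h.fderiv
  have h' : HasFDerivAt
      (fun η => ∑ k, T η k • (ContinuousLinearMap.proj k : (ι → ℝ) →L[ℝ] ℝ)) _
      (expParam ν φ θ) :=
    HasFDerivAt.fun_sum fun k _ => (hasFDerivAt_pi'.1 hT k).smul_const (ContinuousLinearMap.proj k : (ι → ℝ) →L[ℝ] ℝ)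
  rw [iteratedFDeriv_two_apply, h.fderiv_eq, h'.fderiv]
  simp [dotProduct]

end ExpFamily

/-! ### Supersolutions for a non-negative matrix below its inverse spectral radius. -/

section SpectralRadius

open scoped Matrix.Norms.Operator

theorem Matrix.exists_pow_mul_norm_pow_lt {n : Type*} [Fintype n] [DecidableEq n]
    (M : Matrix n n ℂ) {β ε : ℝ} (hβ : 0 ≤ β) (hε : 0 < ε)
    (h : ENNReal.ofReal β < (spectralRadius ℂ M)⁻¹) : ∃ N : ℕ, β ^ N * ‖M ^ N‖ < ε := by
  have h1 : spectralRadius ℂ M < (ENNReal.ofReal β)⁻¹ := ENNReal.lt_inv_iff_lt_inv.1 h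
  -- Gelfand's formula gives ‖M ^ N‖ ≤ c ^ N for large N, and βc < 1.
  obtain ⟨c, hc1, hc2⟩ := ENNReal.lt_iff_exists_nnreal_btwn.1 h1
  have hβc : β * c < 1 := by
    have h2 : ENNReal.ofReal β < (c : ENNReal)⁻¹ := ENNReal.lt_inv_iff_lt_inv.1 hc2
    rcases eq_or_ne c 0 with rfl | hc0
    · simp
    · rw [← ENNReal.coe_inv hc0, ENNReal.ofReal, ENNReal.coe_lt_coe] at h2
      have h3 : β < (c : ℝ)⁻¹ := by
        have := NNReal.coe_lt_coe.2 h2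
        rwa [Real.coe_toNNReal β hβ, NNReal.coe_inv] at this
      have hc : (0 : ℝ) < c := by positivity
      calc β * c < (c : ℝ)⁻¹ * c := by gcongr
        _ = 1 := inv_mul_cancel₀ hc.ne'
  have h4 := (spectrum.pow_nnnorm_pow_one_div_tendsto_nhds_spectralRadius M).eventually_lt_const hc1
  have h5 : ∀ᶠ N : ℕ in Filter.atTop, (β * c) ^ N < ε :=
    (tendsto_pow_atTop_nhds_zero_of_lt_one (by positivity) hβc).eventually_lt_const hε
  obtain ⟨N, h6, h7, h8⟩ := (h4.and (h5.and (Filter.eventually_gt_atTop 0))).exists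
  refine ⟨N, lt_of_le_of_lt ?_ h7⟩
  rw [mul_pow]
  refine mul_le_mul_of_nonneg_left ?_ (by positivity)
  have hN : (0 : ℝ) < N := Nat.cast_pos.2 h8
  have h9 := ENNReal.rpow_le_rpow h6.le hN.le
  rw [← ENNReal.rpow_mul, one_div, inv_mul_cancel₀ hN.ne', ENNReal.rpow_one,
    ENNReal.rpow_natCast, ← ENNReal.coe_pow, ENNReal.coe_le_coe] at h9
  exact_mod_cast h9

/-- A truncated Neumann series v = Σ_{k<N} βᵏAᵏ1 telescopes to v - βAv = 1 - βᴺAᴺ1, which is at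
least 1/2 once the last term is small. This replaces a Perron eigenvector, so irreducibility plays
no role. -/
theorem Matrix.exists_pos_mul_mulVec_le {n : Type*} [Fintype n] [DecidableEq n]
    (A : Matrix n n ℝ) (hA : ∀ i j, 0 ≤ A i j) {β : ℝ} (hβ : 0 ≤ β)
    (h : ENNReal.ofReal β < (spectralRadius ℂ (A.map (algebraMap ℝ ℂ)))⁻¹) :
    ∃ v : n → ℝ, (∀ i, 0 ≤ v i) ∧ ∀ i, β * (A.mulVec v) i + 1 / 2 ≤ v i := by
  obtain ⟨N, hN⟩ := Matrix.exists_pow_mul_norm_pow_lt _ hβ (ε := 1 / 2) (by norm_num) h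
  have hpow : ∀ k i, 0 ≤ ((A ^ k).mulVec 1) i := by
    intro k
    induction k with
    | zero => intro i; simp
    | succ k ih =>
      intro i
      rw [pow_succ', ← Matrix.mulVec_mulVec]
      exact Finset.sum_nonneg fun j _ => mul_nonneg (hA i j) (ih j)
  have hsmall : ∀ i, β ^ N * ((A ^ N).mulVec 1) i ≤ 1 / 2 := by
    intro i
    refine le_trans (mul_le_mul_of_nonneg_left ?_ (by positivity)) hN.le
    have h1 : (((A.map (algebraMap ℝ ℂ)) ^ N).mulVec 1) i =
        algebraMap ℝ ℂ (((A ^ N).mulVec 1) i) := by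
      have h2 : (A.map (algebraMap ℝ ℂ)) ^ N = (A ^ N).map (algebraMap ℝ ℂ) :=
        (map_pow (algebraMap ℝ ℂ).mapMatrix A N).symm
      rw [h2, RingHom.map_mulVec]
      congr 2
    have h3 := (norm_le_pi_norm (((A.map (algebraMap ℝ ℂ)) ^ N).mulVec 1) i).trans
      (Matrix.linfty_opNorm_mulVec _ _)
    rw [h1, norm_algebraMap'] at h3
    have h4 : ‖(1 : n → ℂ)‖ ≤ 1 := (pi_norm_le_iff_of_nonneg zero_le_one).2 fun _ => by simp
    calc ((A ^ N).mulVec 1) i ≤ ‖((A ^ N).mulVec 1) i‖ := le_abs_self _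
      _ ≤ _ := h3
      _ ≤ ‖A.map (algebraMap ℝ ℂ) ^ N‖ * 1 := by gcongr
      _ = _ := mul_one _
  refine ⟨fun i => ∑ k ∈ Finset.range N, β ^ k * ((A ^ k).mulVec 1) i,
    fun i => Finset.sum_nonneg fun k _ => mul_nonneg (by positivity) (hpow k i), fun i => ?_⟩
  have h5 : β * (A.mulVec fun i => ∑ k ∈ Finset.range N, β ^ k * ((A ^ k).mulVec 1) i) i =
      ∑ k ∈ Finset.range N, β ^ (k + 1) * ((A ^ (k + 1)).mulVec 1) i := by
    simp only [pow_succ' A, ← Matrix.mulVec_mulVec]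
    simp only [Matrix.mulVec, dotProduct, Finset.mul_sum]
    rw [Finset.sum_comm]
    refine Finset.sum_congr rfl fun k _ => Finset.sum_congr rfl fun j _ => ?_
    refine Finset.sum_congr rfl fun l _ => ?_
    ring
  have h6 := Finset.sum_range_succ (fun k => β ^ k * ((A ^ k).mulVec 1) i) N
  rw [Finset.sum_range_succ'] at h6
  simp only [pow_zero, Matrix.one_mulVec, Pi.one_apply, mul_one] at h6
  rw [h5]
  linarith [hsmall i]

theorem Matrix.spectralRadius_ne_top {n : Type*} [Fintype n] [DecidableEq n]
    (M : Matrix n n ℂ) : spectralRadius ℂ M ≠ ⊤ := by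
  refine ne_top_of_le_ne_top ?_ (spectrum.spectralRadius_le_pow_nnnorm_pow_one_div ℂ M 0)
  simp [← ENNReal.coe_mul]

end SpectralRadius

/-! ### Weights on directed edges. -/

namespace FactorGraph

variable {V : Type*} [DecidableEq V] (H : FactorGraph V)

theorem DirEdge.eq_of_fst_eq {e e' : H.DirEdge} (h1 : e.1 = e'.1) (h2 : e.2.1 = e'.2.1) :
    e = e' := by
  obtain ⟨α, i⟩ := e
  obtain ⟨β, j⟩ := e'
  obtain rfl : α = β := h1
  obtain rfl : i = j := Subtype.ext h2
  rfl

theorem exists_pos_message {β : ℝ} (hβ : 0 ≤ β)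
    (h : ENNReal.ofReal β < H.perronFrobenius⁻¹) :
    ∃ v : H.DirEdge → ℝ, (∀ e, 0 ≤ v e) ∧
      ∀ e, β * (∑ e', if H.Follows e' e then v e' else 0) + 1 / 2 ≤ v e := by
  have hmap : (Matrix.of fun e e' : H.DirEdge =>
      if H.Follows e' e then (1 : ℝ) else 0).map (algebraMap ℝ ℂ) = H.directedEdgeMatrix := by
    ext e e'
    simp [directedEdgeMatrix, apply_ite]
  obtain ⟨v, hv, hle⟩ := Matrix.exists_pos_mul_mulVec_le
    (Matrix.of fun e e' : H.DirEdge => if H.Follows e' e then (1 : ℝ) else 0)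
    (fun e e' => by rw [Matrix.of_apply]; split_ifs <;> norm_num) hβ (by rw [hmap]; exact h)
  refine ⟨v, hv, fun e => ?_⟩
  simpa [Matrix.mulVec, dotProduct] using hle e

variable [Fintype V]

/-- The weights that compare the pairwise terms of the factors with the vertex terms. -/
theorem exists_weights {β : ℝ} (hβ : 0 ≤ β) (h : ENNReal.ofReal β < H.perronFrobenius⁻¹) :
    ∃ (t : H.DirEdge → ℝ) (c : V → ℝ), (∀ e, 0 ≤ t e) ∧ (∀ i, 0 < c i) ∧ ∀ a : V → ℝ,
      ∑ α : H.Factor, (∑ i : Member α, (1 - t ⟨α, i⟩) ^ 2 * a i.1 ^ 2 +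
        ∑ i : Member α, ∑ j : Member α,
          if i ≠ j then β * (t ⟨α, i⟩ * a i.1) * (t ⟨α, j⟩ * a j.1) else 0) ≤
      ∑ i, (1 - c i) * a i ^ 2 := by
  obtain ⟨v, hv, hle⟩ := H.exists_pos_message hβ h
  -- Chosen so that β|V|δ ≤ 1/2, the slack of the supersolution. It makes y and z strictly positive,
  -- and c_i = δ / y_i is the final gain.
  set δ : ℝ := 1 / (2 * (β * Fintype.card V + 1)) with hδ
  have hδ0 : 0 < δ := by positivity
  set y : V → ℝ := fun i => (∑ e : H.DirEdge, if e.2.1 = i then v e else 0) + δ with hy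
  have hy0 : ∀ i, 0 < y i := fun i =>
    add_pos_of_nonneg_of_pos (Finset.sum_nonneg fun e _ => by split_ifs <;> simp [hv]) hδ0
  set z : H.DirEdge → ℝ := fun e => y e.2.1 - v e with hz
  have hz_eq : ∀ e, z e =
      (∑ e' : H.DirEdge, if e'.2.1 = e.2.1 ∧ e'.1 ≠ e.1 then v e' else 0) + δ := by
    intro e
    have h1 : (∑ e' : H.DirEdge, if e'.2.1 = e.2.1 then v e' else 0) =
        (∑ e' : H.DirEdge, if e'.2.1 = e.2.1 ∧ e'.1 ≠ e.1 then v e' else 0) +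
          ∑ e' : H.DirEdge, if e' = e then v e' else 0 := by
      rw [← Finset.sum_add_distrib]
      refine Finset.sum_congr rfl fun e' _ => ?_
      by_cases h2 : e'.2.1 = e.2.1
      · by_cases h3 : e'.1 = e.1
        · have h4 := DirEdge.eq_of_fst_eq H h3 h2
          subst h4
          simp
        · have h4 : e' ≠ e := fun h => h3 (by rw [h])
          simp [h2, h3, h4]
      · have h4 : e' ≠ e := fun h => h2 (by rw [h])
        simp [h2, h4]
    simp only [hz, hy, h1, Finset.sum_ite_eq', Finset.mem_univ, if_true]
    ring
  have hz0 : ∀ e, 0 < z e := fun e => by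
    rw [hz_eq]
    exact add_pos_of_nonneg_of_pos (Finset.sum_nonneg fun e _ => by split_ifs <;> simp [hv]) hδ0
  -- Expanding z at α → j over all j ≠ i collects exactly the messages on edges e' ⇀ (α → i), plus
  -- at most |V| copies of δ, which the slack 1/2 absorbs.
  have hmsg : ∀ (α : H.Factor) (i : Member α),
      β * (∑ j : Member α, if i ≠ j then z ⟨α, j⟩ else 0) ≤ v ⟨α, i⟩ := by
    intro α i
    have h1 : (∑ j : Member α, if i ≠ j then z ⟨α, j⟩ else 0) ≤
        (∑ e', if H.Follows e' ⟨α, i⟩ then v e' else 0) + Fintype.card V * δ := by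
      have h2 : (∑ j : Member α, if i ≠ j then z ⟨α, j⟩ else 0) ≤
          ∑ j : Member α, ((∑ e' : H.DirEdge,
            if e'.2.1 = j.1 ∧ e'.1 ≠ α ∧ i ≠ j then v e' else 0) + δ) := by
        refine Finset.sum_le_sum fun j _ => ?_
        by_cases hij : i ≠ j
        · simp [hij, hz_eq]
        · simp [hij, hδ0.le]
      refine h2.trans ?_
      rw [Finset.sum_add_distrib]
      refine add_le_add ?_ ?_
      · rw [Finset.sum_comm]
        refine Finset.sum_le_sum fun e' _ => ?_
        by_cases hf : H.Follows e' ⟨α, i⟩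
        · rw [if_pos hf, Finset.sum_eq_single ⟨e'.2.1, hf.1⟩]
          · split_ifs <;> simp [hv]
          · intro j _ hj
            rw [if_neg]
            rintro ⟨h3, -⟩
            exact hj (Subtype.ext h3.symm)
          · simp
        · rw [if_neg hf]
          refine (Finset.sum_eq_zero fun j _ => if_neg ?_).le
          rintro ⟨h3, h4, h5⟩
          refine hf ⟨?_, ?_, h4⟩
          · rw [h3]; exact j.2
          · rw [h3]; exact fun h => h5 (Subtype.ext h.symm)
      · rw [Finset.sum_const, nsmul_eq_mul]
        gcongr
        exact (Finset.card_univ).trans_le (Fintype.card_subtype_le _)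
    have h3 : β * (Fintype.card V * δ) ≤ 1 / 2 := by
      rw [hδ, ← mul_assoc, mul_one_div, div_le_div_iff₀ (by positivity) (by norm_num)]
      linarith
    have h4 := mul_le_mul_of_nonneg_left h1 hβ
    rw [mul_add] at h4
    linarith [hle ⟨α, i⟩]
  refine ⟨fun e => z e / y e.2.1, fun i => δ / y i,
    fun e => div_nonneg (hz0 e).le (hy0 _).le, fun i => div_pos hδ0 (hy0 i), fun a => ?_⟩
  have hpair : ∀ α : H.Factor, (∑ i : Member α, ∑ j : Member α, if i ≠ j then
      β * (z ⟨α, i⟩ / y i.1 * a i.1) * (z ⟨α, j⟩ / y j.1 * a j.1) else 0) ≤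
      ∑ i : Member α, z ⟨α, i⟩ * v ⟨α, i⟩ / y i.1 ^ 2 * a i.1 ^ 2 := by
    intro α
    -- The product of a_i / y_i and a_j / y_j is bounded by half the sum of their squares. After
    -- symmetrization each i keeps z_i (a_i / y_i)² times β Σ_{j≠i} z_j, and `hmsg` applies.
    set P : Member α → Member α → ℝ := fun i j =>
      if i ≠ j then β * (a i.1 ^ 2 * z ⟨α, i⟩ * z ⟨α, j⟩ / y i.1 ^ 2) else 0 with hP
    calc _ ≤ ∑ i : Member α, ∑ j : Member α, (P i j + P j i) / 2 := by
          refine Finset.sum_le_sum fun i _ => Finset.sum_le_sum fun j _ => ?_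
          by_cases hij : i ≠ j
          · simp only [hP, hij, hij.symm, ne_eq, not_false_eq_true, if_true]
            have hi := hy0 i.1
            have hj := hy0 j.1
            have hzz : 0 ≤ β * (z ⟨α, i⟩ * z ⟨α, j⟩) :=
              mul_nonneg hβ (mul_nonneg (hz0 _).le (hz0 _).le)
            have h1 := mul_nonneg hzz (sq_nonneg (a i.1 / y i.1 - a j.1 / y j.1))
            have h2 : ∀ p q : ℝ, (β * (a i.1 ^ 2 * p * q / y i.1 ^ 2) +
                β * (a j.1 ^ 2 * q * p / y j.1 ^ 2)) / 2 -
                β * (p / y i.1 * a i.1) * (q / y j.1 * a j.1) =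
                β * (p * q) * (a i.1 / y i.1 - a j.1 / y j.1) ^ 2 / 2 := fun p q => by
              field_simp
              ring
            have h3 := h2 (z ⟨α, i⟩) (z ⟨α, j⟩)
            linarith
          · obtain rfl : i = j := not_not.1 hij
            simp [hP]
      _ = ∑ i : Member α, ∑ j : Member α, P i j := by
          simp only [← Finset.sum_div, Finset.sum_add_distrib]
          rw [Finset.sum_comm (f := fun i j => P j i)]
          ring
      _ ≤ _ := by
          refine Finset.sum_le_sum fun i _ => ?_
          have h1 : ∑ j, P i j = a i.1 ^ 2 * z ⟨α, i⟩ / y i.1 ^ 2 *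
              (β * ∑ j : Member α, if i ≠ j then z ⟨α, j⟩ else 0) := by
            rw [Finset.mul_sum, Finset.mul_sum]
            refine Finset.sum_congr rfl fun j _ => ?_
            simp only [hP]
            split_ifs
            · ring
            · simp
          rw [h1]
          have h2 := hmsg α i
          have h3 := (hz0 ⟨α, i⟩).le
          calc _ ≤ a i.1 ^ 2 * z ⟨α, i⟩ / y i.1 ^ 2 * v ⟨α, i⟩ := by gcongr
            _ = _ := by ring
  -- Since 1 - t = v / y and v + z = y, the diagonal and pair terms add up to (v² + zv) / y² = v /
  -- y. The messages into i sum to y_i - δ, which gives 1 - c_i.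
  calc _ ≤ ∑ α : H.Factor, ∑ i : Member α, v ⟨α, i⟩ / y i.1 * a i.1 ^ 2 := by
        refine Finset.sum_le_sum fun α _ => ?_
        refine (add_le_add le_rfl (hpair α)).trans_eq ?_
        rw [← Finset.sum_add_distrib]
        refine Finset.sum_congr rfl fun i _ => ?_
        have hi := (hy0 i.1).ne'
        simp only [hz]
        field_simp
        ring
    _ = ∑ e : H.DirEdge, v e / y e.2.1 * a e.2.1 ^ 2 := by
        rw [Fintype.sum_sigma]
    _ = ∑ i, ∑ e : H.DirEdge, if e.2.1 = i then v e / y i * a i ^ 2 else 0 := by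
        rw [Finset.sum_comm]
        refine Finset.sum_congr rfl fun e _ => ?_
        simp
    _ = _ := by
        refine Finset.sum_congr rfl fun i _ => ?_
        have h1 : (∑ e : H.DirEdge, if e.2.1 = i then v e / y i * a i ^ 2 else 0) =
            (∑ e : H.DirEdge, if e.2.1 = i then v e else 0) * (a i ^ 2 / y i) := by
          rw [Finset.sum_mul]
          refine Finset.sum_congr rfl fun e _ => ?_
          split_ifs
          · ring
          · simp
        have h2 : (∑ e : H.DirEdge, if e.2.1 = i then v e else 0) = y i - δ := by simp [hy]
        rw [h1, h2]
        have := (hy0 i).ne'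
        field_simp

theorem sum_degree_mul (f : V → ℝ) :
    ∑ i, (H.degree i : ℝ) * f i = ∑ α : H.Factor, ∑ i : Member α, f i.1 := by
  have h1 : ∀ i, (H.degree i : ℝ) = ∑ α : H.Factor, if i ∈ α.1 then 1 else 0 := fun i => by
    rw [degree, Finset.card_filter, ← Finset.sum_coe_sort]
    push_cast
    rfl
  simp only [h1, Finset.sum_mul]
  rw [Finset.sum_comm]
  refine Finset.sum_congr rfl fun α _ => ?_
  simp only [ite_mul, one_mul, zero_mul]
  rw [← Finset.sum_filter, Finset.sum_coe_sort α.1 f]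
  exact Finset.sum_congr (by ext; simp) fun _ _ => rfl

end FactorGraph

/-! ### Quadratic forms of covariance and correlation matrices. -/

/-- Expand the non-negative value of the form C at C⁻¹x - z. This bounds the inverse covariance from
below without computing it. -/
theorem Matrix.PosSemidef.two_mul_sub_le_inv {n : Type*} [Fintype n] [DecidableEq n]
    {C : Matrix n n ℝ} (hC : C.PosSemidef) (hu : IsUnit C) (x z : n → ℝ) :
    2 * (z ⬝ᵥ x) - z ⬝ᵥ C.mulVec z ≤ C⁻¹.mulVec x ⬝ᵥ x := by
  have hdet : IsUnit C.det := (Matrix.isUnit_iff_isUnit_det _).1 hu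
  have h1 := hC.dotProduct_mulVec_nonneg (C⁻¹.mulVec x - z)
  have h2 : C.mulVec (C⁻¹.mulVec x) = x := by
    rw [Matrix.mulVec_mulVec, Matrix.mul_nonsing_inv C hdet, Matrix.one_mulVec]
  have hT : C.transpose = C := by simpa [Matrix.IsHermitian] using hC.isHermitian
  have h3 : C⁻¹.mulVec x ⬝ᵥ C.mulVec z = z ⬝ᵥ x := by
    rw [Matrix.dotProduct_mulVec, ← Matrix.mulVec_transpose, hT, h2, dotProduct_comm]
  simp only [star_trivial, Matrix.mulVec_sub, dotProduct_sub, sub_dotProduct, h2, h3] at h1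
  linarith

theorem covMatrix_posSemidef {Ω ι : Type*} [MeasurableSpace Ω] [Fintype ι] {μ : Measure Ω}
    [IsFiniteMeasure μ] {f : Ω → ι → ℝ} (hf : ∀ k, MemLp (fun ω => f ω k) 2 μ) :
    (covMatrix μ f f).PosSemidef := by
  refine Matrix.PosSemidef.of_dotProduct_mulVec_nonneg ?_ fun w => ?_
  · ext a b
    exact covariance_comm _ _
  · have h1 := covariance_sum_sum (μ := μ) (X := fun k ω => w k * f ω k)
      (Y := fun k ω => w k * f ω k) (fun k => (hf k).const_mul _) (fun k => (hf k).const_mul _)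
    have h2 : 0 ≤ cov[∑ k, fun ω => w k * f ω k, ∑ k, fun ω => w k * f ω k; μ] := by
      rw [covariance_self (memLp_finsetSum' _ fun k _ => (hf k).const_mul _).aemeasurable]
      exact variance_nonneg _ _
    rw [h1] at h2
    refine h2.trans_eq ?_
    simp only [star_trivial, dotProduct, Matrix.mulVec, covMatrix, Matrix.of_apply,
      covariance_const_mul_left, covariance_const_mul_right, Finset.mul_sum]
    refine Finset.sum_congr rfl fun a _ => Finset.sum_congr rfl fun b _ => ?_
    ring

section Correlation

open scoped MatrixOrder Matrix.Norms.L2Operator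

theorem Matrix.dotProduct_mulVec_le_l2_opNorm {m n : Type*} [Fintype m] [Fintype n]
    [DecidableEq n] (A : Matrix m n ℝ) (x : m → ℝ) (y : n → ℝ) :
    x ⬝ᵥ A.mulVec y ≤ ‖A‖ * Real.sqrt (x ⬝ᵥ x) * Real.sqrt (y ⬝ᵥ y) := by
  have hx : ‖WithLp.toLp 2 x‖ = Real.sqrt (x ⬝ᵥ x) := by
    rw [EuclideanSpace.norm_eq]
    simp [dotProduct, sq]
  have hy : ‖WithLp.toLp 2 y‖ = Real.sqrt (y ⬝ᵥ y) := by
    rw [EuclideanSpace.norm_eq]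
    simp [dotProduct, sq]
  have h1 := real_inner_le_norm (WithLp.toLp 2 (A.mulVec y)) (WithLp.toLp 2 x)
  have h2 := Matrix.l2_opNorm_mulVec A (WithLp.toLp 2 y)
  rw [EuclideanSpace.inner_toLp_toLp, star_trivial, hx] at h1
  rw [hy] at h2
  calc x ⬝ᵥ A.mulVec y ≤ ‖WithLp.toLp 2 (A.mulVec y)‖ * Real.sqrt (x ⬝ᵥ x) := h1
    _ ≤ (‖A‖ * Real.sqrt (y ⬝ᵥ y)) * Real.sqrt (x ⬝ᵥ x) := by
        gcongr
        exact h2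
    _ = _ := by ring

theorem Matrix.PosSemidef.inv_mulVec_eq {n : Type*} [Fintype n] [DecidableEq n]
    {C : Matrix n n ℝ} (hC : C.PosSemidef) (x : n → ℝ) :
    C⁻¹.mulVec x = (CFC.sqrt C)⁻¹.mulVec ((CFC.sqrt C)⁻¹.mulVec x) := by
  rw [Matrix.mulVec_mulVec, ← Matrix.mul_inv_rev, CFC.sqrt_mul_sqrt_self C hC.nonneg]

theorem Matrix.transpose_inv_sqrt {n : Type*} [Fintype n] [DecidableEq n]
    (C : Matrix n n ℝ) : ((CFC.sqrt C)⁻¹).transpose = (CFC.sqrt C)⁻¹ := by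
  have h : (CFC.sqrt C).PosSemidef := Matrix.nonneg_iff_posSemidef.1 (CFC.sqrt_nonneg C)
  have hT : (CFC.sqrt C).transpose = CFC.sqrt C := by
    simpa [Matrix.IsHermitian] using h.isHermitian
  rw [Matrix.transpose_nonsing_inv, hT]

theorem Matrix.inv_sqrt_mulVec_dotProduct {n : Type*} [Fintype n] [DecidableEq n]
    (C : Matrix n n ℝ) (x y : n → ℝ) :
    (CFC.sqrt C)⁻¹.mulVec x ⬝ᵥ y = x ⬝ᵥ (CFC.sqrt C)⁻¹.mulVec y := by
  rw [Matrix.dotProduct_mulVec, ← Matrix.mulVec_transpose, Matrix.transpose_inv_sqrt]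

/-- Moving one inverse square root from each side onto the covariance turns the left side into the
correlation matrix evaluated at whitened vectors. -/
theorem dotProduct_covMatrix_mulVec_le {Ω ι κ : Type*} [MeasurableSpace Ω] [Fintype ι]
    [DecidableEq ι] [Fintype κ] [DecidableEq κ] {μ : Measure Ω} {f : Ω → ι → ℝ} {g : Ω → κ → ℝ}
    (hf : (covMatrix μ f f).PosSemidef) (hg : (covMatrix μ g g).PosSemidef)
    (x : ι → ℝ) (y : κ → ℝ) :
    (covMatrix μ f f)⁻¹.mulVec x ⬝ᵥ (covMatrix μ f g).mulVec ((covMatrix μ g g)⁻¹.mulVec y) ≤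
      opNorm (corrMatrix μ f g) * Real.sqrt ((covMatrix μ f f)⁻¹.mulVec x ⬝ᵥ x) *
        Real.sqrt ((covMatrix μ g g)⁻¹.mulVec y ⬝ᵥ y) := by
  have h := Matrix.dotProduct_mulVec_le_l2_opNorm (corrMatrix μ f g)
    ((CFC.sqrt (covMatrix μ f f))⁻¹.mulVec x) ((CFC.sqrt (covMatrix μ g g))⁻¹.mulVec y)
  rw [hf.inv_mulVec_eq x, hg.inv_mulVec_eq y, Matrix.inv_sqrt_mulVec_dotProduct,
    Matrix.inv_sqrt_mulVec_dotProduct (covMatrix μ f f) _ x,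
    Matrix.inv_sqrt_mulVec_dotProduct (covMatrix μ g g) _ y]
  rwa [corrMatrix, ← Matrix.mulVec_mulVec, ← Matrix.mulVec_mulVec] at h

end Correlation

/-! ### Second derivatives: coordinate-free form and Hessian matrix. -/

section SecondDerivative

variable {E F : Type*} [NormedAddCommGroup E] [NormedSpace ℝ E] [NormedAddCommGroup F]
  [NormedSpace ℝ F]

theorem ContDiffAt.differentiableAt_fderiv_of_two {f : E → ℝ} {x : E} (hf : ContDiffAt ℝ 2 f x) :
    DifferentiableAt ℝ (fderiv ℝ f) x :=
  (hf.fderiv_right (m := 1) (by norm_num)).differentiableAt one_ne_zero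

theorem iteratedFDeriv_two_comp_continuousLinearMap {f : F → ℝ} (L : E →L[ℝ] F) {x : E}
    (hf : ContDiffAt ℝ 2 f (L x)) (u v : E) :
    iteratedFDeriv ℝ 2 (fun y => f (L y)) x ![u, v] = iteratedFDeriv ℝ 2 f (L x) ![L u, L v] := by
  have hev : ∀ᶠ y in nhds x, DifferentiableAt ℝ f (L y) :=
    (L.continuous.tendsto x).eventually
      ((hf.eventually (by simp)).mono fun y h => h.differentiableAt (by norm_num))
  have h : fderiv ℝ (fun y => f (L y)) =ᶠ[nhds x]
      fun y => (ContinuousLinearMap.compL ℝ E F ℝ).flip L (fderiv ℝ f (L y)) := by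
    filter_upwards [hev] with y hy
    exact (hy.hasFDerivAt.comp y L.hasFDerivAt).fderiv
  have h' := ((ContinuousLinearMap.compL ℝ E F ℝ).flip L).hasFDerivAt.comp x
    (hf.differentiableAt_fderiv_of_two.hasFDerivAt.comp x L.hasFDerivAt)
  rw [iteratedFDeriv_two_apply, iteratedFDeriv_two_apply, h.fderiv_eq]
  erw [h'.fderiv]
  simp

theorem hessian_apply {ι : Type*} [Fintype ι] [DecidableEq ι] {f : (ι → ℝ) → ℝ}
    {x : ι → ℝ} (hf : ContDiffAt ℝ 2 f x) (a b : ι) :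
    hessian f x a b = fderiv ℝ (fderiv ℝ f) x (Pi.single a 1) (Pi.single b 1) := by
  have h1 := hf.differentiableAt_fderiv_of_two.hasFDerivAt.clm_apply
    (hasFDerivAt_const (Pi.single b 1 : ι → ℝ) x)
  rw [hessian, Matrix.of_apply, h1.fderiv]
  simp

theorem dotProduct_hessian_mulVec {ι : Type*} [Fintype ι] [DecidableEq ι] {f : (ι → ℝ) → ℝ}
    {x : ι → ℝ} (hf : ContDiffAt ℝ 2 f x) (v : ι → ℝ) :
    v ⬝ᵥ (hessian f x).mulVec v = iteratedFDeriv ℝ 2 f x ![v, v] := by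
  rw [iteratedFDeriv_two_apply]
  have hv : v = ∑ a, v a • (Pi.single a 1 : ι → ℝ) := by
    ext k
    simp [Pi.single_apply]
  simp only [Matrix.cons_val_zero, Matrix.cons_val_one]
  conv_rhs => rw [hv]
  simp only [map_sum, map_smul, sum_apply, smul_apply, smul_eq_mul, dotProduct, Matrix.mulVec,
    hessian_apply hf,
    Finset.mul_sum]
  rw [Finset.sum_comm]
  refine Finset.sum_congr rfl fun a _ => Finset.sum_congr rfl fun b _ => ?_
  ring

theorem hessian_isHermitian {ι : Type*} [Fintype ι] [DecidableEq ι] {f : (ι → ℝ) → ℝ}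
    {x : ι → ℝ} (hf : ContDiffAt ℝ 2 f x) : (hessian f x).IsHermitian := by
  ext a b
  rw [Matrix.conjTranspose_apply, star_trivial, hessian_apply hf, hessian_apply hf]
  exact (hf.isSymmSndFDerivAt (by simp)).eq _ _

end SecondDerivative

theorem exists_ofReal_lt_forall_le {ι : Type*} [Finite ι] (f : ι → ℝ) {K : ENNReal} (hK : 0 < K)
    (h : ∀ i, ENNReal.ofReal (f i) < K) :
    ∃ β : ℝ, 0 ≤ β ∧ ENNReal.ofReal β < K ∧ ∀ i, f i ≤ β := by
  -- The extra value 0 makes β non-negative and covers an empty index type.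
  obtain ⟨m, hm⟩ := Finite.exists_max fun o : Option ι => o.elim 0 f
  refine ⟨m.elim 0 f, hm none, ?_, fun i => hm (some i)⟩
  cases m with
  | none => simpa using hK
  | some i => exact h i

/-! ### The quadratic form of the Bethe free energy. -/

namespace LocalStatistics

variable {V : Type*} [Fintype V] [DecidableEq V] {H : FactorGraph V}
  {X : V → Type*} [∀ i, MeasurableSpace (X i)] (I : LocalStatistics H X)

open FactorGraph

theorem measurable_fullStat (α : H.Factor) : Measurable (I.fullStat α) := by
  refine measurable_pi_iff.2 fun k => ?_
  rcases k with k | ⟨i, k⟩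
  · exact (measurable_pi_apply k).comp (I.fStat_measurable α)
  · exact (measurable_pi_apply k).comp ((I.vStat_measurable i.1).comp (measurable_pi_apply i))

instance (i : V) : NeZero (I.base i) := ⟨I.base_ne_zero i⟩

instance (α : H.Factor) : NeZero (I.fBase α) := by
  refine ⟨fun h => ?_⟩
  have := fun i : Member α => I.base_sigmaFinite i.1
  have h1 : I.fBase α Set.univ = ∏ i : Member α, I.base i.1 Set.univ := Measure.pi_univ _
  rw [h, Measure.coe_zero, Pi.zero_apply] at h1
  obtain ⟨i, -, hi⟩ := Finset.prod_eq_zero_iff.1 h1.symm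
  exact I.base_ne_zero i.1 (Measure.measure_univ_eq_zero.1 hi)

/-- The linear map `η ↦ η_i`. -/
noncomputable def vPartCLM (i : V) : (I.Coord → ℝ) →L[ℝ] (Fin (I.r i) → ℝ) :=
  ContinuousLinearMap.pi fun k => ContinuousLinearMap.proj (Sum.inr ⟨i, k⟩)

/-- The linear map `η ↦ η_α`. -/
noncomputable def fPartCLM (α : H.Factor) : (I.Coord → ℝ) →L[ℝ] (I.FIndex α → ℝ) :=
  ContinuousLinearMap.pi fun k => ContinuousLinearMap.proj
    (Sum.elim (fun k => Sum.inl ⟨α, k⟩) (fun p => Sum.inr ⟨p.1.1, p.2⟩) k)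

theorem vPartCLM_apply (i : V) (η : I.Coord → ℝ) : I.vPartCLM i η = I.vPart η i := rfl

theorem fPartCLM_apply (α : H.Factor) (η : I.Coord → ℝ) : I.fPartCLM α η = I.fPart η α := by
  ext k
  rcases k with k | p <;> rfl

/-- The vector with blocks `w_i` in the vertex components and `0` in the factor components. -/
def vertexBlocks (α : H.Factor) (w : ∀ i : Member α, Fin (I.r i.1) → ℝ) : I.FIndex α → ℝ :=
  Sum.elim 0 fun p => w p.1 p.2

theorem vertexBlocks_dotProduct_fPart (α : H.Factor) (w : ∀ i : Member α, Fin (I.r i.1) → ℝ)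
    (u : I.Coord → ℝ) :
    I.vertexBlocks α w ⬝ᵥ I.fPart u α = ∑ i, w i ⬝ᵥ I.vPart u i.1 := by
  simp [vertexBlocks, dotProduct, fPart, Fintype.sum_sum_type, Fintype.sum_sigma]

theorem vertexBlocks_dotProduct_covMatrix (α : H.Factor)
    (w : ∀ i : Member α, Fin (I.r i.1) → ℝ) (μ : Measure (I.Config α)) :
    I.vertexBlocks α w ⬝ᵥ (covMatrix μ (I.fullStat α) (I.fullStat α)).mulVec (I.vertexBlocks α w) =
      ∑ i, ∑ j, w i ⬝ᵥ (covMatrix μ (I.vStatOn α i) (I.vStatOn α j)).mulVec (w j) := by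
  simp only [vertexBlocks, dotProduct, Matrix.mulVec, fullStat, Fintype.sum_sum_type,
    Fintype.sum_sigma, covMatrix, Matrix.of_apply, Sum.elim_inl, Sum.elim_inr, Pi.zero_apply,
    zero_mul, mul_zero, Finset.sum_const_zero, zero_add]
  refine Finset.sum_congr rfl fun i _ => ?_
  rw [Finset.sum_comm]
  simp only [Finset.mul_sum]

/-- The squared norm of the vertex components with respect to the inverse covariance. -/
noncomputable def vertexNorm (W : ∀ i, Matrix (Fin (I.r i)) (Fin (I.r i)) ℝ) (u : I.Coord → ℝ)
    (i : V) : ℝ :=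
  Real.sqrt ((W i)⁻¹.mulVec (I.vPart u i) ⬝ᵥ I.vPart u i)

theorem vertexNorm_sq {W : ∀ i, Matrix (Fin (I.r i)) (Fin (I.r i)) ℝ} (hW : ∀ i, (W i).PosDef)
    (u : I.Coord → ℝ) (i : V) :
    I.vertexNorm W u i ^ 2 = (W i)⁻¹.mulVec (I.vPart u i) ⬝ᵥ I.vPart u i := by
  refine Real.sq_sqrt ?_
  rw [dotProduct_comm]
  simpa using (hW i).inv.posSemidef.dotProduct_mulVec_nonneg (I.vPart u i)

/-- The inverse covariance is tested against t_i W_i⁻¹ u_i in the vertex blocks and 0 in the factor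
block. Diagonal blocks then give t_i² a_i² exactly, off-diagonal ones are bounded through the
correlation norm, and a_i² - (1 - t_i)² a_i² = 2 t_i a_i² - t_i² a_i². -/
theorem le_factor_quadratic {W : ∀ i, Matrix (Fin (I.r i)) (Fin (I.r i)) ℝ}
    (hW : ∀ i, (W i).PosDef) (α : H.Factor) {μ : Measure (I.Config α)}
    (hC : (covMatrix μ (I.fullStat α) (I.fullStat α)).PosDef)
    (hmarg : ∀ i : Member α, covMatrix μ (I.vStatOn α i) (I.vStatOn α i) = W i.1) {β : ℝ}
    (hβ : ∀ i j : Member α, i ≠ j → opNorm (corrMatrix μ (I.vStatOn α i) (I.vStatOn α j)) ≤ β)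
    {t : Member α → ℝ} (ht : ∀ i, 0 ≤ t i) (u : I.Coord → ℝ) :
    ∑ i : Member α, I.vertexNorm W u i.1 ^ 2 -
      (∑ i : Member α, (1 - t i) ^ 2 * I.vertexNorm W u i.1 ^ 2 +
        ∑ i : Member α, ∑ j : Member α, if i ≠ j then
          β * (t i * I.vertexNorm W u i.1) * (t j * I.vertexNorm W u j.1) else 0) ≤
      (covMatrix μ (I.fullStat α) (I.fullStat α))⁻¹.mulVec (I.fPart u α) ⬝ᵥ I.fPart u α := by
  set a := I.vertexNorm W u with ha
  have ha2 : ∀ i, (W i)⁻¹.mulVec (I.vPart u i) ⬝ᵥ I.vPart u i = a i ^ 2 := fun i =>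
    (I.vertexNorm_sq hW u i).symm
  set w : ∀ i : Member α, Fin (I.r i.1) → ℝ := fun i => t i • (W i.1)⁻¹.mulVec (I.vPart u i.1)
    with hw
  refine le_trans ?_ (hC.posSemidef.two_mul_sub_le_inv hC.isUnit (I.fPart u α)
    (I.vertexBlocks α w))
  have h1 : I.vertexBlocks α w ⬝ᵥ I.fPart u α = ∑ i : Member α, t i * a i.1 ^ 2 := by
    rw [vertexBlocks_dotProduct_fPart]
    refine Finset.sum_congr rfl fun i _ => ?_
    rw [hw, smul_dotProduct, smul_eq_mul, ha2]
  have h2 : ∀ i j : Member α,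
      w i ⬝ᵥ (covMatrix μ (I.vStatOn α i) (I.vStatOn α j)).mulVec (w j) ≤
        (if i = j then t i ^ 2 * a i.1 ^ 2 else 0) +
          if i ≠ j then β * (t i * a i.1) * (t j * a j.1) else 0 := by
    intro i j
    simp only [hw, smul_dotProduct, Matrix.mulVec_smul, dotProduct_smul, smul_eq_mul]
    by_cases hij : i = j
    · subst hij
      have hdet : IsUnit (W i.1).det := (Matrix.isUnit_iff_isUnit_det _).1 (hW i.1).isUnit
      rw [hmarg, Matrix.mulVec_mulVec, Matrix.mul_nonsing_inv _ hdet, Matrix.one_mulVec, ha2]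
      simp only [if_true, ne_eq, not_true_eq_false, if_false, add_zero]
      exact le_of_eq (by ring)
    · rw [if_neg hij, if_pos hij, zero_add]
      have h3 := dotProduct_covMatrix_mulVec_le (μ := μ) (f := I.vStatOn α i)
        (g := I.vStatOn α j) (by rw [hmarg]; exact (hW _).posSemidef)
        (by rw [hmarg]; exact (hW _).posSemidef) (I.vPart u i.1) (I.vPart u j.1)
      rw [hmarg, hmarg] at h3
      have h4 := h3.trans (mul_le_mul_of_nonneg_right (mul_le_mul_of_nonneg_right (hβ i j hij)
        (Real.sqrt_nonneg _)) (Real.sqrt_nonneg _))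
      have h5 := mul_le_mul_of_nonneg_left h4 (mul_nonneg (ht i) (ht j))
      calc _ = t i * t j * ((W i.1)⁻¹.mulVec (I.vPart u i.1) ⬝ᵥ
            (covMatrix μ (I.vStatOn α i) (I.vStatOn α j)).mulVec
              ((W j.1)⁻¹.mulVec (I.vPart u j.1))) := by ring
        _ ≤ t i * t j * (β * a i.1 * a j.1) := h5
        _ = _ := by ring
  have h6 : I.vertexBlocks α w ⬝ᵥ
      (covMatrix μ (I.fullStat α) (I.fullStat α)).mulVec (I.vertexBlocks α w) ≤
      ∑ i : Member α, t i ^ 2 * a i.1 ^ 2 + ∑ i : Member α, ∑ j : Member α,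
        if i ≠ j then β * (t i * a i.1) * (t j * a j.1) else 0 := by
    rw [vertexBlocks_dotProduct_covMatrix]
    refine (Finset.sum_le_sum fun i _ => Finset.sum_le_sum fun j _ => h2 i j).trans_eq ?_
    simp only [Finset.sum_add_distrib, Finset.sum_ite_eq, Finset.mem_univ, if_true]
  have h7 : ∑ i : Member α, (1 - t i) ^ 2 * a i.1 ^ 2 = ∑ i : Member α, a i.1 ^ 2 -
      2 * ∑ i : Member α, t i * a i.1 ^ 2 + ∑ i : Member α, t i ^ 2 * a i.1 ^ 2 := by
    rw [Finset.mul_sum, ← Finset.sum_sub_distrib, ← Finset.sum_add_distrib]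
    exact Finset.sum_congr rfl fun i _ => by ring
  rw [h1, h7]
  linarith

/-- Positivity of the quadratic form of the Hessian of the Bethe free energy. -/
theorem bethe_quadratic_pos {W : ∀ i, Matrix (Fin (I.r i)) (Fin (I.r i)) ℝ}
    (hW : ∀ i, (W i).PosDef) {μ : ∀ α : H.Factor, Measure (I.Config α)}
    (hC : ∀ α, (covMatrix (μ α) (I.fullStat α) (I.fullStat α)).PosDef)
    (hmarg : ∀ (α : H.Factor) (i : Member α),
      covMatrix (μ α) (I.vStatOn α i) (I.vStatOn α i) = W i.1)
    (hcorr : ∀ (α : H.Factor) (i j : Member α), i ≠ j →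
      ENNReal.ofReal (opNorm (corrMatrix (μ α) (I.vStatOn α i) (I.vStatOn α j))) <
        H.perronFrobenius⁻¹)
    {u : I.Coord → ℝ} (hu : u ≠ 0) :
    0 < ∑ α, (covMatrix (μ α) (I.fullStat α) (I.fullStat α))⁻¹.mulVec (I.fPart u α) ⬝ᵥ
        I.fPart u α +
      ∑ i, (1 - (H.degree i : ℝ)) * ((W i)⁻¹.mulVec (I.vPart u i) ⬝ᵥ I.vPart u i) := by
  -- The weighted bound sees only vertex components, so directions supported on the factor
  -- coordinates are treated separately.
  by_cases hv : ∀ i, I.vPart u i = 0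
  · simp only [hv, dotProduct_zero, mul_zero, Finset.sum_const_zero, add_zero]
    have hnn : ∀ α, 0 ≤ (covMatrix (μ α) (I.fullStat α) (I.fullStat α))⁻¹.mulVec (I.fPart u α) ⬝ᵥ
        I.fPart u α := fun α => by
      rw [dotProduct_comm]
      simpa using (hC α).inv.posSemidef.dotProduct_mulVec_nonneg (I.fPart u α)
    have hex : ∃ α, I.fPart u α ≠ 0 := by
      by_contra! h
      refine hu (funext fun p => ?_)
      rcases p with ⟨α, k⟩ | ⟨i, k⟩
      · exact congrFun (h α) (Sum.inl k)
      · exact congrFun (hv i) k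
    obtain ⟨α, hα⟩ := hex
    refine Finset.sum_pos' (fun α _ => hnn α) ⟨α, Finset.mem_univ α, ?_⟩
    rw [dotProduct_comm]
    simpa using (hC α).inv.dotProduct_mulVec_pos hα
  · push Not at hv
    obtain ⟨i₀, hi₀⟩ := hv
    -- Finitely many strict bounds leave room for one common β < κ⁻¹; κ⁻¹ > 0 is needed when no
    -- factor has two members.
    obtain ⟨β, hβ0, hβ, hle⟩ := exists_ofReal_lt_forall_le
      (fun p : {p : Σ α : H.Factor, Member α × Member α // p.2.1 ≠ p.2.2} =>
        opNorm (corrMatrix (μ p.1.1) (I.vStatOn p.1.1 p.1.2.1) (I.vStatOn p.1.1 p.1.2.2)))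
      (K := H.perronFrobenius⁻¹)
      (ENNReal.inv_pos.2 (Matrix.spectralRadius_ne_top _))
      fun p => hcorr _ _ _ p.2
    obtain ⟨t, c, ht, hc, hw⟩ := H.exists_weights hβ0 hβ
    have hfac := Finset.sum_le_sum fun α (_ : α ∈ Finset.univ) =>
      I.le_factor_quadratic hW α (hC α) (hmarg α) (fun i j hij => hle ⟨⟨α, i, j⟩, hij⟩)
        (t := fun i => t ⟨α, i⟩) (fun i => ht _) u
    rw [Finset.sum_sub_distrib, ← H.sum_degree_mul fun i => I.vertexNorm W u i ^ 2] at hfac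
    have hver := hw (I.vertexNorm W u)
    simp only [← I.vertexNorm_sq hW]
    have hpos : 0 < ∑ i, c i * I.vertexNorm W u i ^ 2 := by
      refine Finset.sum_pos' (fun i _ => mul_nonneg (hc i).le (sq_nonneg _))
        ⟨i₀, Finset.mem_univ _, mul_pos (hc i₀) ?_⟩
      rw [I.vertexNorm_sq hW, dotProduct_comm]
      simpa using (hW i₀).inv.dotProduct_mulVec_pos hi₀
    simp only [sub_mul, one_mul, Finset.sum_sub_distrib] at hver ⊢
    linarith

theorem contDiffAt_betheFreeEnergy (θbar : ∀ α : H.Factor, I.FIndex α → ℝ) {η : I.Coord → ℝ}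
    (hf : ∀ α, ContDiffAt ℝ 2 (ExpFamily.legendre (I.fBase α) (I.fullStat α)) (I.fPart η α))
    (hv : ∀ i, ContDiffAt ℝ 2 (ExpFamily.legendre (I.base i) (I.vStat i)) (I.vPart η i)) :
    ContDiffAt ℝ 2 (I.betheFreeEnergy θbar) η ∧ ∀ u,
      iteratedFDeriv ℝ 2 (I.betheFreeEnergy θbar) η ![u, u] =
        ∑ α, iteratedFDeriv ℝ 2 (ExpFamily.legendre (I.fBase α) (I.fullStat α)) (I.fPart η α)
          ![I.fPart u α, I.fPart u α] +
        ∑ i, (1 - (H.degree i : ℝ)) * iteratedFDeriv ℝ 2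
          (ExpFamily.legendre (I.base i) (I.vStat i)) (I.vPart η i)
          ![I.vPart u i, I.vPart u i] := by
  set L : (I.Coord → ℝ) →L[ℝ] ℝ :=
    -∑ α, ∑ k, θbar α k • (ContinuousLinearMap.proj k).comp (I.fPartCLM α) with hL
  have hF : I.betheFreeEnergy θbar = fun η => (L η +
      ∑ α, ExpFamily.legendre (I.fBase α) (I.fullStat α) (I.fPartCLM α η)) +
      ∑ i, (1 - (H.degree i : ℝ)) • ExpFamily.legendre (I.base i) (I.vStat i) (I.vPartCLM i η) := by
    funext η
    simp [betheFreeEnergy, hL, fPartCLM_apply, vPartCLM_apply]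
  simp only [← fPartCLM_apply, ← vPartCLM_apply] at hf hv ⊢
  have hf' : ∀ α, ContDiffAt ℝ 2 (fun η => ExpFamily.legendre (I.fBase α) (I.fullStat α)
      (I.fPartCLM α η)) η := fun α => (hf α).comp η (I.fPartCLM α).contDiff.contDiffAt
  have hv' : ∀ i, ContDiffAt ℝ 2 (fun η => ExpFamily.legendre (I.base i) (I.vStat i)
      (I.vPartCLM i η)) η := fun i => (hv i).comp η (I.vPartCLM i).contDiff.contDiffAt
  have hv'' : ∀ i, ContDiffAt ℝ 2 (fun η => (1 - (H.degree i : ℝ)) •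
      ExpFamily.legendre (I.base i) (I.vStat i) (I.vPartCLM i η)) η := fun i =>
    (hv' i).const_smul _
  have hL' : ContDiffAt ℝ 2 L η := L.contDiff.contDiffAt
  have hsf : ContDiffAt ℝ 2 (fun η => ∑ α, ExpFamily.legendre (I.fBase α) (I.fullStat α)
      (I.fPartCLM α η)) η := ContDiffAt.sum fun α _ => hf' α
  have hsv : ContDiffAt ℝ 2 (fun η => ∑ i, (1 - (H.degree i : ℝ)) •
      ExpFamily.legendre (I.base i) (I.vStat i) (I.vPartCLM i η)) η :=
    ContDiffAt.sum fun i _ => hv'' i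
  rw [hF]
  refine ⟨(hL'.add hsf).add hsv, fun u => ?_⟩
  have h0 : iteratedFDeriv ℝ 2 L η ![u, u] = 0 := by
    rw [iteratedFDeriv_two_apply]
    have : fderiv ℝ L = fun _ => L := funext fun x => L.fderiv
    simp [this]
  have h1 : ∀ α, iteratedFDeriv ℝ 2 (fun η => ExpFamily.legendre (I.fBase α) (I.fullStat α)
      (I.fPartCLM α η)) η ![u, u] = _ := fun α =>
    iteratedFDeriv_two_comp_continuousLinearMap (I.fPartCLM α) (hf α) u u
  have h2 : ∀ i, iteratedFDeriv ℝ 2 (fun η => (1 - (H.degree i : ℝ)) •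
      ExpFamily.legendre (I.base i) (I.vStat i) (I.vPartCLM i η)) η ![u, u] =
      (1 - (H.degree i : ℝ)) * iteratedFDeriv ℝ 2 (ExpFamily.legendre (I.base i) (I.vStat i))
        (I.vPartCLM i η) ![I.vPartCLM i u, I.vPartCLM i u] := fun i => by
    rw [← iteratedFDeriv_two_comp_continuousLinearMap (I.vPartCLM i) (hv i) u u]
    have h := iteratedFDeriv_const_smul_apply (i := 2) (a := (1 - (H.degree i : ℝ))) (hv' i)
    exact congrArg (fun m => m ![u, u]) h
  rw [fun_iteratedFDeriv_add_apply (i := 2) (hL'.add hsf) hsv,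
    fun_iteratedFDeriv_add_apply (i := 2) hL' hsf,
    iteratedFDeriv_fun_sum_apply (n := 2) fun α _ => hf' α,
    iteratedFDeriv_fun_sum_apply (n := 2) fun i _ => hv'' i]
  simp only [add_apply, sum_apply, h0, h1, h2,
    zero_add]

end LocalStatistics

/-! ### Covariances of beliefs and consistency with the vertex families. -/

namespace ExpFamily

variable {X : Type*} [MeasurableSpace X] {ι : Type*} [Fintype ι] {ν : Measure X}
  {φ : X → ι → ℝ} {η : ι → ℝ}

theorem invExpParam_mem (h : η ∈ expSpace ν φ) : invExpParam ν φ η ∈ natSpace ν φ :=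
  Function.invFunOn_mem h

theorem expParam_invExpParam (h : η ∈ expSpace ν φ) : expParam ν φ (invExpParam ν φ η) = η :=
  Function.invFunOn_eq h

theorem posDef_covMatrix_law [NeZero ν] [DecidableEq ι] {θ : ι → ℝ} (hφ : Measurable φ)
    (hθ : θ ∈ natSpace ν φ) (h : IsUnit (hessian (logPartition ν φ) θ)) :
    (covMatrix (law ν φ θ) φ φ).PosDef := by
  have := isProbabilityMeasure_law hθ
  rw [hessian_logPartition hφ hθ] at h
  exact (covMatrix_posSemidef fun k => memLp_stat hφ hθ k).posDef_iff_isUnit.2 h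

/-- Both inverse covariances are the Hessian of the same Legendre transform at the same point. Thus
the covariance depends only on the expectation parameter, and uniqueness of θ need not be proved. -/
theorem covMatrix_law_eq_of_expParam_eq [NeZero ν] [DecidableEq ι] {θ θ' : ι → ℝ}
    (hφ : Measurable φ) (hθ : θ ∈ natSpace ν φ) (hθ' : θ' ∈ natSpace ν φ)
    (hunit : IsUnit (covMatrix (law ν φ θ) φ φ)) (hunit' : IsUnit (covMatrix (law ν φ θ') φ φ))
    (h : expParam ν φ θ = expParam ν φ θ') :
    covMatrix (law ν φ θ) φ φ = covMatrix (law ν φ θ') φ φ := by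
  have hinv : (covMatrix (law ν φ θ) φ φ)⁻¹ = (covMatrix (law ν φ θ') φ φ)⁻¹ := by
    ext a b
    have h1 := iteratedFDeriv_two_legendre hφ hθ hunit (Pi.single b 1) (Pi.single a 1)
    rw [h, iteratedFDeriv_two_legendre hφ hθ' hunit'] at h1
    simpa using h1.symm
  rw [← Matrix.nonsing_inv_nonsing_inv _ ((Matrix.isUnit_iff_isUnit_det _).1 hunit), hinv,
    Matrix.nonsing_inv_nonsing_inv _ ((Matrix.isUnit_iff_isUnit_det _).1 hunit')]

end ExpFamily

namespace InferenceFamily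

variable {V : Type*} [Fintype V] [DecidableEq V] {H : FactorGraph V}
  {X : V → Type*} [∀ i, MeasurableSpace (X i)] (I : InferenceFamily H X)

open FactorGraph ExpFamily

theorem covMatrix_belief_eq {η : I.Coord → ℝ} (hη : η ∈ I.pseudomarginals) (α : H.Factor)
    (i : Member α) :
    covMatrix (I.belief η α) (I.vStatOn α i) (I.vStatOn α i) =
      covMatrix (law (I.base i.1) (I.vStat i.1)
        (invExpParam (I.base i.1) (I.vStat i.1) (I.vPart η i.1))) (I.vStat i.1) (I.vStat i.1) := by
  obtain ⟨θ', hθ', hmap⟩ := I.marginally_closed α i _ (invExpParam_mem (hη.1 α))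
  have hmeas : ∀ k, Measurable fun x => I.vStat i.1 x k := fun k =>
    (measurable_pi_apply k).comp (I.vStat_measurable i.1)
  have hproj : Measurable fun x : I.Config α => x i := measurable_pi_apply i
  -- The marginal of b_α has mean η_i because the vertex components of η_α are the η_i themselves.
  have hexp : expParam (I.base i.1) (I.vStat i.1) θ' = I.vPart η i.1 := by
    ext k
    rw [expParam, ← hmap, integral_map hproj.aemeasurable (hmeas k).aestronglyMeasurable]
    exact congrFun (expParam_invExpParam (hη.1 α)) (Sum.inr ⟨i, k⟩)
  rw [← covMatrix_law_eq_of_expParam_eq (I.vStat_measurable i.1) hθ' (invExpParam_mem (hη.2 i.1))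
    (posDef_covMatrix_law (I.vStat_measurable i.1) hθ' (I.vHessian_isUnit _ _ hθ')).isUnit
    (posDef_covMatrix_law (I.vStat_measurable i.1) (invExpParam_mem (hη.2 i.1))
      (I.vHessian_isUnit _ _ (invExpParam_mem (hη.2 i.1)))).isUnit
    (hexp.trans (expParam_invExpParam (hη.2 i.1)).symm), ← hmap]
  ext a b
  exact (covariance_map (hmeas a).aestronglyMeasurable (hmeas b).aestronglyMeasurable
    hproj.aemeasurable).symm

end InferenceFamily

/-! ### Assembly of the convexity theorem. -/

theorem corollary3 {V : Type*} [Fintype V] [DecidableEq V] (H : FactorGraph V)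
    {X : V → Type*} [∀ i, MeasurableSpace (X i)] (I : InferenceFamily H X)
    (θbar : ∀ α : H.Factor, I.FIndex α → ℝ) :
    ∀ η ∈ I.pseudomarginalsBelow H.perronFrobenius⁻¹,
      ContDiffAt ℝ 2 (I.betheFreeEnergy θbar) η ∧
        (hessian (I.betheFreeEnergy θbar) η).PosDef := by
  rintro η ⟨hη, hcorr⟩
  have hθf := fun α => ExpFamily.invExpParam_mem (hη.1 α)
  have hθv := fun i => ExpFamily.invExpParam_mem (hη.2 i)
  have hCf := fun α => ExpFamily.posDef_covMatrix_law (I.measurable_fullStat α) (hθf α)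
    (I.fHessian_isUnit α _ (hθf α))
  have hCv := fun i => ExpFamily.posDef_covMatrix_law (I.vStat_measurable i) (hθv i)
    (I.vHessian_isUnit i _ (hθv i))
  have hLf := fun α => ExpFamily.contDiffAt_legendre (I.measurable_fullStat α) (hθf α)
    (hCf α).isUnit
  have hLv := fun i => ExpFamily.contDiffAt_legendre (I.vStat_measurable i) (hθv i) (hCv i).isUnit
  have hDf := fun α => ExpFamily.iteratedFDeriv_two_legendre (I.measurable_fullStat α) (hθf α)
    (hCf α).isUnit
  have hDv := fun i => ExpFamily.iteratedFDeriv_two_legendre (I.vStat_measurable i) (hθv i)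
    (hCv i).isUnit
  simp only [ExpFamily.expParam_invExpParam (hη.1 _)] at hLf hDf
  simp only [ExpFamily.expParam_invExpParam (hη.2 _)] at hLv hDv
  obtain ⟨hcd, hD⟩ := I.contDiffAt_betheFreeEnergy θbar hLf hLv
  refine ⟨hcd, Matrix.PosDef.of_dotProduct_mulVec_pos (hessian_isHermitian hcd) fun u hu => ?_⟩
  rw [star_trivial, dotProduct_hessian_mulVec hcd, hD]
  simp only [hDf, hDv]
  exact I.bethe_quadratic_pos hCv hCf (I.covMatrix_belief_eq hη) hcorr hu
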